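/- Let $d\ge 2$. Let $c_n$ be the number of $n$-step self-avoiding walks from the origin in the hypercubic lattice $\mathbb Z^d$, and let $\mu_d=\lim_{n\to\infty}c_n^{1/n}$. Let $c_n^+(v)$ be the number of those walks all of whose vertices have non-negative last coordinate and which have exactly $v$ vertices, other than the starting point, with last coordinate $0$. For $a>0$ put $$A_n^+(a)=\sum_{v=0}^n c_n^+(v)\,a^v,\qquad \mathcal A^+(a)=\lim_{n\to\infty}\tfrac1n\log A_n^+(a),$$ let $a_c^+=\sup\{a>0:\mathcal A^+(a)=\log\mu_d\}$, and let $\lambda_a=\mu_d$ if $a\le a_c^+$ and $\lambda_a=e^{\mathcal A^+(a)}$ if $a>a_c^+$. Let $$g_N(a,t)=\sum_{n=0}^N \frac{A_n^+(a)}{\lambda_a^n}\,t^n ,$$ and for $\rho\in(0,1)$ let $\nu_N(\rho)$ be the number of zeros $t\in\mathbb C$ of the polynomial $g_N(a,\cdot)$, counted with multiplicity, with $1-\rho\le|t|\le\frac1{1-\rho}$. Then these quantities are well defined: the limits $\mu_d$ and $\mathcal A^+(a)$ (for every $a>0$) exist and are finite, $0<a_c^+<\infty$, and for $a>0$ one has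 $\mathcal A^+(a)=\log\mu_d$ if $a\le a_c^+$ and $\mathcal A^+(a)>\log\mu_d$ if $a>a_c^+$. Moreover, for every $a>0$, the zeros of $g_N(a,t)$ converge on the unit circle in the following sense: for every $\rho\in(0,1)$ and $\epsilon>0$ there is an $N_0$ such that for all $N\ge N_0$, $$\left|1-\tfrac1N\,\nu_N(\rho)\right|<\epsilon .$$ -/

import Mathlib

open Filter Topology Polynomial

namespace AdsorbingWalk

/-- The `d`-dimensional hypercubic lattice: vertices `ℤ^d`, edges between points at
`ℓ¹`-distance one. -/
def lattice (d : ℕ) : SimpleGraph (Fin d → ℤ) where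
  Adj x y := ∑ i, |x i - y i| = 1
  symm := ⟨fun x y h => by
    have e : ∀ i, |y i - x i| = |x i - y i| := fun i => abs_sub_comm _ _
    simpa only [e] using h⟩
  loopless := ⟨fun x h => by simp at h⟩

/-- The last (`d`-th) coordinate of a lattice point. -/
def height {d : ℕ} [NeZero d] (x : Fin d → ℤ) : ℤ :=
  x ⟨d - 1, Nat.sub_lt (NeZero.pos d) one_pos⟩

/-- Self-avoiding walks of length `n` from the origin, as sequences of `n + 1` vertices. -/
def walks (d n : ℕ) : Set (Fin (n + 1) → Fin d → ℤ) :=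
  {w | w 0 = 0 ∧ (∀ i : Fin n, (lattice d).Adj (w i.castSucc) (w i.succ)) ∧
    Function.Injective w}

/-- Positive walks: self-avoiding walks from the origin in the half-lattice. -/
def positiveWalks (d n : ℕ) [NeZero d] : Set (Fin (n + 1) → Fin d → ℤ) :=
  {w | w ∈ walks d n ∧ ∀ j, 0 ≤ height (w j)}

/-- The number of visits: vertices of the walk, other than the starting point, that lie in
the boundary hyperplane of the half-lattice. -/
def visits {d n : ℕ} [NeZero d] (w : Fin (n + 1) → Fin d → ℤ) : ℕ :=
  (Finset.univ.filter fun j => j ≠ 0 ∧ height (w j) = 0).card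

theorem finite_walks (d n : ℕ) : (walks d n).Finite := by
  refine (Set.finite_Icc (fun _ _ => -(n : ℤ) : Fin (n + 1) → Fin d → ℤ)
    (fun _ _ => (n : ℤ))).subset ?_
  rintro w ⟨h0, hadj, -⟩
  have key : ∀ j : Fin (n + 1), ∀ i, |w j i| ≤ (j : ℕ) := by
    intro j
    induction j using Fin.induction with
    | zero => intro i; simp [h0]
    | succ k ih =>
      intro i
      have h1 : ∑ i, |w k.castSucc i - w k.succ i| = 1 := hadj k
      have h2 : |w k.castSucc i - w k.succ i| ≤ 1 := by
        rw [← h1]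
        exact Finset.single_le_sum (f := fun i => |w k.castSucc i - w k.succ i|)
          (fun _ _ => abs_nonneg _) (Finset.mem_univ i)
      have h3 := ih i
      rw [abs_le] at h2 h3 ⊢
      simp only [Fin.val_castSucc, Fin.val_succ, Nat.cast_add, Nat.cast_one] at h3 ⊢
      constructor <;> linarith [h2.1, h2.2, h3.1, h3.2]
  have hb : ∀ j i, |w j i| ≤ (n : ℤ) := fun j i =>
    (key j i).trans (by exact_mod_cast Nat.lt_succ_iff.mp j.isLt)
  exact ⟨fun j i => (abs_le.mp (hb j i)).1, fun j i => (abs_le.mp (hb j i)).2⟩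

/-- The number of self-avoiding walks of length `n` from the origin in the full lattice. -/
noncomputable def walkCount (d n : ℕ) : ℕ := (walks d n).ncard

/-- The number of positive walks of length `n` with exactly `v` visits. -/
noncomputable def positiveCount (d n v : ℕ) [NeZero d] : ℕ :=
  {w | w ∈ positiveWalks d n ∧ visits w = v}.ncard

/-- The partition function of adsorbing walks of length `n` at activity `a`. -/
noncomputable def partitionFn (d n : ℕ) [NeZero d] (a : ℝ) : ℝ :=
  ∑ v ∈ Finset.range (n + 1), (positiveCount d n v : ℝ) * a ^ v

/-- The growth constant of self-avoiding walks, the limit of the `n`-th roots of the number of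
walks of length `n`. -/
noncomputable def growthConstant (d : ℕ) : ℝ :=
  limUnder atTop fun n : ℕ => (walkCount d n : ℝ) ^ (1 / (n : ℝ))

/-- The limiting free energy of adsorbing walks. -/
noncomputable def freeEnergy (d : ℕ) [NeZero d] (a : ℝ) : ℝ :=
  limUnder atTop fun n : ℕ => 1 / (n : ℝ) * Real.log (partitionFn d n a)

/-- The adsorption critical point: the end of the range of activities on which the free energy
equals the logarithm of the growth constant. -/
noncomputable def criticalPoint (d : ℕ) [NeZero d] : ℝ :=
  sSup {a : ℝ | 0 < a ∧ freeEnergy d a = Real.log (growthConstant d)}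

open Classical in
/-- The growth rate `λ_a`. -/
noncomputable def growthRate (d : ℕ) [NeZero d] (a : ℝ) : ℝ :=
  if a ≤ criticalPoint d then growthConstant d else Real.exp (freeEnergy d a)

/-- The rescaled partial generating function, as a complex polynomial in `t`. -/
noncomputable def rescaledGF (d N : ℕ) [NeZero d] (a : ℝ) : ℂ[X] :=
  ∑ n ∈ Finset.range (N + 1),
    C ((partitionFn d n a / growthRate d a ^ n : ℝ) : ℂ) * X ^ n

open Classical in
/-- The number of zeros of `P`, with multiplicity, in the annulus
`1 - ρ ≤ |t| ≤ 1 / (1 - ρ)`. -/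
noncomputable def annulusZeros (P : ℂ[X]) (ρ : ℝ) : ℕ :=
  (P.roots.filter fun t => 1 - ρ ≤ ‖t‖ ∧ ‖t‖ ≤ 1 / (1 - ρ)).card

end AdsorbingWalk

/-!
The partition function of positive walks grows like the larger one of two exponentials, and the
statement on zeros only uses that the rescaled coefficients are positive and have subexponential
growth.

*Unfolding.* Fix a coordinate `e`. Take the last point of a self-avoiding walk at which `e` is
maximal: reflecting the rest of the walk in the hyperplane through this point gives again a
self-avoiding walk.
Iterating, the excesses met on the way are strictly decreasing and add up to at most `n`, so that
`O(√n)` folds make the maximum sit at the end (`IsSAW.exists_foldAll`). A fold at a prescribed time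
is an involution, hence an `n`-step walk has at most `(n + 2) ^ O(√n)` preimages, which is
subexponential. This is the argument of Hammersley and Welsh, with a slightly weaker bound. It is
carried out for loops with respect to an additive height function `h` that does not depend on
the coordinate `e`: folds then preserve the number of visits (`sum_loops_le`). With `h = 0`, loops
are all self-avoiding walks, so the same lemma serves the walks in the full lattice.

*Free energy.* Bridges can be glued by means of one extra step, so Fekete's lemma gives a growth
rate `l` of weighted bridges along the surface; subadditivity gives the growth rate `κ` of all
self-avoiding walks. A positive walk, cut at its last visit, is a loop followed by a self-avoiding
walk, which bounds the free energy by `max l κ`. It is at least `l` since bridges along the surface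
are positive walks, and at least `κ` since vertical bridges, lifted by one step, are positive walks
without visits (`tendsto_log_positiveSum`). The phase diagram follows because the free energy is
monotone, Lipschitz in `log a`, equal to `κ` at `a = 1` and at least `log a`
(`phase_separation`).

*Zeros.* For a polynomial with `P(0) ≠ 0`, the sum of `|log ‖z‖|` over the zeros `z` equals
`2 log M(P) - log |lead P| - log |P(0)|`, where the Mahler measure `M(P)` is at most the sum of the
absolute values of the coefficients. For the rescaled generating function this is `o(N)`, while
each zero outside the annulus contributes at least `- log (1 - ρ)` (`tendsto_annulusZeros`).
-/

namespace AdsorbingWalk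

/-! ### Exponential growth rates of positive sequences -/

theorem exists_le_const_mul_exp {s : ℕ → ℝ} {L δ : ℝ} (hs : ∀ n, 0 < s n)
    (h : Tendsto (fun n : ℕ => 1 / (n : ℝ) * Real.log (s n)) atTop (𝓝 L)) (hδ : 0 < δ) :
    ∃ C : ℝ, 0 < C ∧ ∀ n, s n ≤ C * Real.exp ((L + δ) * n) := by
  have hev : ∀ᶠ n : ℕ in atTop, s n / Real.exp ((L + δ) * n) ≤ 1 := by
    filter_upwards [h.eventually (gt_mem_nhds (show L < L + δ by linarith)),
      eventually_gt_atTop 0] with n hn hn0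
    have hn' : (0 : ℝ) < n := by exact_mod_cast hn0
    rw [div_le_one (Real.exp_pos _), ← Real.log_le_iff_le_exp (hs n)]
    rw [one_div, inv_mul_lt_iff₀ hn'] at hn
    linarith
  obtain ⟨C, hC⟩ := (isBoundedUnder_of_eventually_le hev).bddAbove_range
  refine ⟨max C 1, by positivity, fun n => ?_⟩
  have := hC ⟨n, rfl⟩
  simp only at this
  rw [div_le_iff₀ (Real.exp_pos _)] at this
  exact this.trans (by gcongr; exact le_max_left _ _)

theorem tendsto_log_add_one_div :
    Tendsto (fun n : ℕ => Real.log ((n : ℝ) + 1) / n) atTop (𝓝 0) := by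
  have h1 : Tendsto (fun n : ℕ => Real.log ((n : ℝ) + 1) / ((n : ℝ) + 1)) atTop (𝓝 0) :=
    (Real.isLittleO_log_id_atTop.tendsto_div_nhds_zero).comp
      (tendsto_atTop_add_const_right _ (1 : ℝ) tendsto_natCast_atTop_atTop)
  have h2 : Tendsto (fun n : ℕ => 2 * (Real.log ((n : ℝ) + 1) / ((n : ℝ) + 1))) atTop (𝓝 0) := by
    simpa using h1.const_mul 2
  refine squeeze_zero' (Eventually.of_forall fun n => ?_) ?_ h2
  · exact div_nonneg (Real.log_nonneg (by simp)) (by positivity)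
  · filter_upwards [eventually_ge_atTop 1] with n hn
    have hn' : (1 : ℝ) ≤ n := by exact_mod_cast hn
    have hl : 0 ≤ Real.log ((n : ℝ) + 1) := Real.log_nonneg (by linarith)
    rw [← mul_div_assoc, div_le_div_iff₀ (by linarith) (by linarith)]
    nlinarith

/-! ### Zeros of polynomials away from the unit circle -/

theorem card_filter_mul_le_sum_map {α : Type*} (s : Multiset α) (q : α → Prop) [DecidablePred q]
    {f : α → ℝ} {K : ℝ} (hf : ∀ x, 0 ≤ f x) (hq : ∀ x, q x → K ≤ f x) :
    ((s.filter q).card : ℝ) * K ≤ (s.map f).sum := by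
  induction s using Multiset.induction with
  | empty => simp
  | cons x s ih =>
    by_cases hx : q x
    · rw [Multiset.filter_cons_of_pos _ hx, Multiset.map_cons, Multiset.sum_cons,
        Multiset.card_cons]
      push_cast
      linarith [hq x hx]
    · rw [Multiset.filter_cons_of_neg _ hx, Multiset.map_cons, Multiset.sum_cons]
      linarith [hf x]

/-- The sum of `|log ‖z‖|` over the zeros is controlled by the Mahler measure, since
`|log ‖z‖| = 2 log⁺ ‖z‖ - log ‖z‖` and the zeros have product `± P(0) / lead(P)`. -/
theorem sum_abs_log_norm_roots (P : ℂ[X]) (h0 : P.coeff 0 ≠ 0) :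
    (P.roots.map fun z => |Real.log ‖z‖|).sum =
      2 * P.logMahlerMeasure - Real.log ‖P.leadingCoeff‖ - Real.log ‖P.coeff 0‖ := by
  have hP : P ≠ 0 := by rintro rfl; simp at h0
  have hroot : ∀ z ∈ P.roots, z ≠ 0 := by
    rintro z hz rfl
    rw [mem_roots hP, IsRoot, ← coeff_zero_eq_eval_zero] at hz
    exact h0 hz
  have hprod : Real.log ‖P.coeff 0‖ =
      Real.log ‖P.leadingCoeff‖ + (P.roots.map fun z => Real.log ‖z‖).sum := by
    rw [(IsAlgClosed.splits P).coeff_zero_eq_leadingCoeff_mul_prod_roots]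
    have hne : P.roots.prod ≠ 0 := by
      rw [Ne, Multiset.prod_eq_zero_iff]
      exact fun h => hroot 0 h rfl
    rw [norm_mul, norm_mul, norm_pow, norm_neg, norm_one, one_pow, one_mul,
      Real.log_mul (by simpa using hP) (by simpa using hne)]
    congr 1
    have hn : ‖P.roots.prod‖ = (P.roots.map fun z => ‖z‖).prod :=
      map_multiset_prod (normHom : ℂ →*₀ ℝ) P.roots
    rw [hn, Real.log_multiset_prod, Multiset.map_map]
    · rfl
    · intro x hx
      obtain ⟨z, hz, rfl⟩ := Multiset.mem_map.1 hx
      simpa using hroot z hz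
  have habs : ∀ z : ℂ, |Real.log ‖z‖| = 2 * Real.posLog ‖z‖ - Real.log ‖z‖ := by
    intro z
    rw [Real.posLog]
    rcases le_total 0 (Real.log ‖z‖) with h | h
    · rw [max_eq_right h, abs_of_nonneg h]; ring
    · rw [max_eq_left h, abs_of_nonpos h]; ring
  simp only [habs, Multiset.sum_map_sub, Multiset.sum_map_mul_left]
  rw [logMahlerMeasure_eq_log_leadingCoeff_add_sum_log_roots, hprod]
  ring

theorem natDegree_sub_annulusZeros_mul_le (P : ℂ[X]) (h0 : P.coeff 0 ≠ 0) {ρ : ℝ} (hρ1 : ρ < 1) :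
    ((P.natDegree : ℝ) - annulusZeros P ρ) * -Real.log (1 - ρ) ≤
      2 * Real.log (P.sum fun _ c => ‖c‖) - Real.log ‖P.leadingCoeff‖ -
        Real.log ‖P.coeff 0‖ := by
  classical
  have hP : P ≠ 0 := by rintro rfl; simp at h0
  have hcard : (P.natDegree : ℝ) - annulusZeros P ρ =
      (P.roots.filter fun t => ¬(1 - ρ ≤ ‖t‖ ∧ ‖t‖ ≤ 1 / (1 - ρ))).card := by
    have h := congrArg Multiset.card
      (Multiset.filter_add_not (fun t : ℂ => 1 - ρ ≤ ‖t‖ ∧ ‖t‖ ≤ 1 / (1 - ρ)) P.roots)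
    rw [Multiset.card_add, IsAlgClosed.card_roots_eq_natDegree] at h
    rw [← h, annulusZeros]
    push_cast
    simp only [add_sub_cancel_left]
  have hroot : ∀ z ∈ P.roots, z ≠ 0 := by
    rintro z hz rfl
    rw [mem_roots hP, IsRoot, ← coeff_zero_eq_eval_zero] at hz
    exact h0 hz
  have hfilter : (P.roots.filter fun t => ¬(1 - ρ ≤ ‖t‖ ∧ ‖t‖ ≤ 1 / (1 - ρ))) =
      P.roots.filter fun t => t ≠ 0 ∧ ¬(1 - ρ ≤ ‖t‖ ∧ ‖t‖ ≤ 1 / (1 - ρ)) :=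
    Multiset.filter_congr fun z hz => by simp [hroot z hz]
  rw [hcard, hfilter]
  refine (card_filter_mul_le_sum_map _ _ (f := fun z => |Real.log ‖z‖|)
    (fun _ => abs_nonneg _) ?_).trans ?_
  · rintro z ⟨hz0, hz⟩
    have hz' : 0 < ‖z‖ := norm_pos_iff.2 hz0
    rw [not_and_or, not_le, not_le] at hz
    rcases hz with hz | hz
    · have := Real.log_lt_log hz' hz
      exact (by linarith : -Real.log (1 - ρ) ≤ -Real.log ‖z‖).trans (neg_le_abs _)
    · have := Real.log_lt_log (by have : 0 < 1 - ρ := by linarith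
                                  positivity) hz
      rw [one_div, Real.log_inv] at this
      exact this.le.trans (le_abs_self _)
  · rw [sum_abs_log_norm_roots P h0, logMahlerMeasure_eq_log_MahlerMeasure]
    have := Real.log_le_log (mahlerMeasure_pos_of_ne_zero hP) (mahlerMeasure_le_sum_norm_coeff P)
    linarith

/-- A Jentzsch–Szegő phenomenon: if positive coefficients satisfy `(p n) ^ (1 / n) → 1`, then all
but `o(N)` zeros of the `N`-th partial sum of `∑ p n * t ^ n` lie near the unit circle. -/
theorem tendsto_annulusZeros {p : ℕ → ℝ} (hp : ∀ n, 0 < p n)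
    (hlim : Tendsto (fun n : ℕ => 1 / (n : ℝ) * Real.log (p n)) atTop (𝓝 0))
    {ρ : ℝ} (hρ : 0 < ρ) (hρ1 : ρ < 1) {ε : ℝ} (hε : 0 < ε) :
    ∃ N₀ : ℕ, ∀ N : ℕ, N₀ ≤ N → |1 - 1 / (N : ℝ) * (annulusZeros
      (∑ n ∈ Finset.range (N + 1), C ((p n : ℝ) : ℂ) * X ^ n) ρ : ℝ)| < ε := by
  set K := -Real.log (1 - ρ) with hK
  have hK0 : 0 < K := by
    have := Real.log_neg (show 0 < 1 - ρ by linarith) (by linarith)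
    linarith
  set δ := ε * K / 4 with hδ
  have hδ0 : 0 < δ := by positivity
  obtain ⟨B, hB0, hB⟩ := exists_le_const_mul_exp hp hlim hδ0
  have hconst : Tendsto (fun N : ℕ => 2 * (Real.log ((N : ℝ) + 1) / N) +
      (2 * Real.log B - Real.log (p 0)) / N) atTop (𝓝 0) := by
    simpa using (tendsto_log_add_one_div.const_mul 2).add
      (tendsto_const_div_atTop_nhds_zero_nat (2 * Real.log B - Real.log (p 0)))
  have hev : ∀ᶠ N : ℕ in atTop, |1 - 1 / (N : ℝ) * (annulusZeros
      (∑ n ∈ Finset.range (N + 1), C ((p n : ℝ) : ℂ) * X ^ n) ρ : ℝ)| < ε := by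
    filter_upwards [hconst.eventually (gt_mem_nhds hδ0),
      hlim.eventually (lt_mem_nhds (show -δ < 0 by linarith)),
      eventually_gt_atTop 0] with N h1 h2 hN
    have hN' : (0 : ℝ) < N := by exact_mod_cast hN
    set P : ℂ[X] := ∑ n ∈ Finset.range (N + 1), C ((p n : ℝ) : ℂ) * X ^ n with hPdef
    have hcoeff : ∀ k, P.coeff k = if k < N + 1 then ((p k : ℝ) : ℂ) else 0 := by
      intro k
      simp [hPdef, coeff_C_mul, coeff_X_pow]
    have hdeg : P.natDegree = N := by
      refine natDegree_eq_of_le_of_coeff_ne_zero ?_ ?_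
      · rw [natDegree_le_iff_coeff_eq_zero]
        intro k hk
        rw [hcoeff, if_neg (by omega)]
      · rw [hcoeff, if_pos (by omega)]
        exact_mod_cast (hp N).ne'
    have hc0 : P.coeff 0 = ((p 0 : ℝ) : ℂ) := by rw [hcoeff, if_pos (by omega)]
    have hlead : P.leadingCoeff = ((p N : ℝ) : ℂ) := by
      rw [leadingCoeff, hdeg, hcoeff, if_pos (by omega)]
    have hmain := natDegree_sub_annulusZeros_mul_le P
      (by rw [hc0]; exact_mod_cast (hp 0).ne') hρ1
    have hle : annulusZeros P ρ ≤ N := by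
      rw [← hdeg, annulusZeros, ← IsAlgClosed.card_roots_eq_natDegree]
      exact Multiset.card_le_card (Multiset.filter_le _ _)
    have hsum : (P.sum fun _ c => ‖c‖) = ∑ n ∈ Finset.range (N + 1), p n := by
      rw [sum_over_range _ (by simp), hdeg]
      refine Finset.sum_congr rfl fun k hk => ?_
      rw [hcoeff, if_pos (Finset.mem_range.1 hk), Complex.norm_of_nonneg (hp k).le]
    have hsum_le : ∑ n ∈ Finset.range (N + 1), p n ≤ ((N : ℝ) + 1) * (B * Real.exp (δ * N)) := by
      have : ∀ n ∈ Finset.range (N + 1), p n ≤ B * Real.exp (δ * N) := by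
        intro n hn
        have hn : (n : ℝ) ≤ N := by exact_mod_cast Nat.lt_succ_iff.1 (Finset.mem_range.1 hn)
        refine (hB n).trans ?_
        rw [zero_add]
        gcongr
      simpa using Finset.sum_le_card_nsmul _ _ _ this
    have hlog : Real.log (∑ n ∈ Finset.range (N + 1), p n) ≤
        Real.log ((N : ℝ) + 1) + (Real.log B + δ * N) := by
      refine (Real.log_le_log (Finset.sum_pos (fun n _ => hp n) (by simp)) hsum_le).trans ?_
      rw [Real.log_mul (by positivity) (by positivity), Real.log_mul hB0.ne' (by positivity),
        Real.log_exp]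
    rw [hsum, hlead, hc0, hdeg, Complex.norm_of_nonneg (hp _).le,
      Complex.norm_of_nonneg (hp _).le, ← hK] at hmain
    have h2' : -δ * N < Real.log (p N) := by
      rw [one_div, lt_inv_mul_iff₀ hN'] at h2
      linarith
    have h1' : 2 * Real.log ((N : ℝ) + 1) + (2 * Real.log B - Real.log (p 0)) < δ * N := by
      rw [← mul_div_assoc, ← add_div, div_lt_iff₀ hN'] at h1
      exact h1
    have hle' : (annulusZeros P ρ : ℝ) ≤ N := by exact_mod_cast hle
    have hfin : ((N : ℝ) - annulusZeros P ρ) * K < ε * N * K := by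
      have : ε * N * K = 4 * (δ * N) := by rw [hδ]; ring
      linarith
    have hfin' := lt_of_mul_lt_mul_right hfin hK0.le
    have heq : 1 - 1 / (N : ℝ) * (annulusZeros P ρ : ℝ) = (N - annulusZeros P ρ) / N := by
      field_simp
    rw [heq, abs_of_nonneg (div_nonneg (by linarith) hN'.le), div_lt_iff₀ hN']
    exact hfin'
  exact eventually_atTop.1 hev

/-! ### Self-avoiding walks as stopped sequences -/

/-- An `n`-step self-avoiding walk from the origin, encoded as a sequence indexed by `ℕ` that is
constant from time `n` on. Compared with sequences indexed by `Fin (n + 1)`, this makes cutting,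
gluing and reversing walks plain operations on the time variable. -/
structure IsSAW {d : ℕ} (n : ℕ) (w : ℕ → Fin d → ℤ) : Prop where
  zero : w 0 = 0
  adj : ∀ i < n, (lattice d).Adj (w i) (w (i + 1))
  ne : ∀ i j, i < j → j ≤ n → w i ≠ w j
  constant : ∀ i, n ≤ i → w i = w n

theorem IsSAW.restrict_mem_walks {d n : ℕ} {w : ℕ → Fin d → ℤ} (hw : IsSAW n w) :
    (fun i : Fin (n + 1) => w i) ∈ walks d n := by
  refine ⟨hw.zero, fun i => hw.adj i i.isLt, fun i j hij => ?_⟩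
  rcases lt_trichotomy i j with h | h | h
  · exact absurd hij (hw.ne i j h (by omega))
  · exact h
  · exact absurd hij.symm (hw.ne j i h (by omega))

theorem IsSAW.ext_of_le {d n : ℕ} {w w' : ℕ → Fin d → ℤ} (hw : IsSAW n w) (hw' : IsSAW n w')
    (h : ∀ i ≤ n, w i = w' i) : w = w' := by
  funext i
  rcases le_total i n with hi | hi
  · exact h i hi
  · rw [hw.constant i hi, hw'.constant i hi, h n le_rfl]

theorem injOn_restrict (d n : ℕ) :
    Set.InjOn (fun (w : ℕ → Fin d → ℤ) (i : Fin (n + 1)) => w i) {w | IsSAW n w} := by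
  intro w hw w' hw' h
  exact hw.ext_of_le hw' fun i hi => congrFun h ⟨i, by omega⟩

theorem finite_isSAW (d n : ℕ) : {w : ℕ → Fin d → ℤ | IsSAW n w}.Finite :=
  Set.Finite.of_injOn (fun _ hw => hw.restrict_mem_walks) (injOn_restrict d n)
    (finite_walks d n)

/-- The stopped sequence of a walk indexed by `Fin (n + 1)`. -/
def stopped {d n : ℕ} (W : Fin (n + 1) → Fin d → ℤ) (i : ℕ) : Fin d → ℤ :=
  W ⟨min i n, by omega⟩

theorem stopped_coe {d n : ℕ} (W : Fin (n + 1) → Fin d → ℤ) (i : Fin (n + 1)) :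
    stopped W i = W i := by
  unfold stopped
  congr 1
  ext
  simp only
  omega

theorem isSAW_stopped {d n : ℕ} {W : Fin (n + 1) → Fin d → ℤ} (hW : W ∈ walks d n) :
    IsSAW n (stopped W) where
  zero := by
    rw [← hW.1]
    exact stopped_coe W 0
  adj i hi := by
    have := hW.2.1 ⟨i, hi⟩
    rw [← stopped_coe W, ← stopped_coe W] at this
    exact this
  ne i j hij hj h := by
    have := hW.2.2 (a₁ := ⟨i, by omega⟩) (a₂ := ⟨j, by omega⟩)
      (by rw [← stopped_coe W, ← stopped_coe W]; exact h)
    simp only [Fin.mk.injEq] at this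
    omega
  constant i hi := by
    unfold stopped
    congr 2
    omega

theorem IsSAW.abs_sub_succ_le {d n : ℕ} {w : ℕ → Fin d → ℤ} (hw : IsSAW n w) (e : Fin d) {i : ℕ}
    (hi : i < n) : |w i e - w (i + 1) e| ≤ 1 := by
  have h : ∑ k, |w i k - w (i + 1) k| = 1 := hw.adj i hi
  rw [← h]
  exact Finset.single_le_sum (f := fun k => |w i k - w (i + 1) k|)
    (fun _ _ => abs_nonneg _) (Finset.mem_univ e)

theorem IsSAW.sub_le {d n : ℕ} {w : ℕ → Fin d → ℤ} (hw : IsSAW n w) (e : Fin d) (s k : ℕ)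
    (hk : s + k ≤ n) : w (s + k) e - w s e ≤ k := by
  induction k with
  | zero => simp
  | succ k ih =>
    have h1 := ih (by omega)
    have h2 := abs_le.1 (hw.abs_sub_succ_le e (i := s + k) (by omega))
    push_cast
    rw [← add_assoc]
    linarith [h2.1]

/-- The `n`-step self-avoiding walks from the origin. -/
noncomputable def saws (d n : ℕ) : Finset (ℕ → Fin d → ℤ) := (finite_isSAW d n).toFinset

@[simp] theorem mem_saws {d n : ℕ} {w : ℕ → Fin d → ℤ} : w ∈ saws d n ↔ IsSAW n w := by
  simp [saws]

open Classical in
/-- The self-avoiding walks on which the height function `h` stays non-negative. -/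
noncomputable def positiveSaws {d : ℕ} (h : (Fin d → ℤ) →+ ℤ) (n : ℕ) :
    Finset (ℕ → Fin d → ℤ) :=
  (saws d n).filter fun w => ∀ i, 0 ≤ h (w i)

open Classical in
/-- The positive self-avoiding walks that end at height zero. For `h = 0` these are all
self-avoiding walks. -/
noncomputable def loops {d : ℕ} (h : (Fin d → ℤ) →+ ℤ) (n : ℕ) : Finset (ℕ → Fin d → ℤ) :=
  (saws d n).filter fun w => (∀ i, 0 ≤ h (w i)) ∧ h (w n) = 0

open Classical in
/-- The loops on which the coordinate `e` is weakly minimal at the start and weakly maximal at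
the end. -/
noncomputable def bridges {d : ℕ} (h : (Fin d → ℤ) →+ ℤ) (e : Fin d) (n : ℕ) :
    Finset (ℕ → Fin d → ℤ) :=
  (loops h n).filter fun w => ∀ i, 0 ≤ w i e ∧ w i e ≤ w n e

/-- The weight `a ^ v` of an `n`-step walk, where `v` is the number of its vertices at height zero,
the starting point excluded. -/
def weight {d : ℕ} (h : (Fin d → ℤ) →+ ℤ) (a : ℝ) (n : ℕ) (w : ℕ → Fin d → ℤ) : ℝ :=
  ∏ i ∈ Finset.range n, if h (w (i + 1)) = 0 then a else 1

theorem weight_pos {d : ℕ} (h : (Fin d → ℤ) →+ ℤ) {a : ℝ} (ha : 0 < a) (n : ℕ)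
    (w : ℕ → Fin d → ℤ) : 0 < weight h a n w :=
  Finset.prod_pos fun _ _ => by split_ifs <;> positivity

theorem weight_le {d : ℕ} (h : (Fin d → ℤ) →+ ℤ) {a : ℝ} (ha : 0 < a) (n : ℕ)
    (w : ℕ → Fin d → ℤ) : weight h a n w ≤ max a 1 ^ n := by
  rw [weight, ← Finset.card_range n, ← Finset.prod_const, Finset.card_range]
  refine Finset.prod_le_prod (fun _ _ => by split_ifs <;> positivity) fun _ _ => ?_
  split_ifs
  exacts [le_max_left _ _, le_max_right _ _]

/-! ### Comparison of weighted sums -/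

theorem sum_le_sum_of_injOn {α β : Type*} {s : Finset α} {t : Finset β} {u : α → ℝ} {v : β → ℝ}
    (f : α → β) (hf : ∀ x ∈ s, f x ∈ t) (hinj : Set.InjOn f s) (huv : ∀ x ∈ s, u x ≤ v (f x))
    (hv : ∀ y ∈ t, 0 ≤ v y) : ∑ x ∈ s, u x ≤ ∑ y ∈ t, v y := by
  classical
  calc ∑ x ∈ s, u x ≤ ∑ x ∈ s, v (f x) := Finset.sum_le_sum huv
    _ = ∑ y ∈ s.image f, v y := (Finset.sum_image hinj).symm
    _ ≤ ∑ y ∈ t, v y := Finset.sum_le_sum_of_subset_of_nonneg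
        (Finset.image_subset_iff.2 hf) fun y hy _ => hv y hy

theorem sum_le_sum_sum_filter {α ι : Type*} {s : Finset α} {T : Finset ι} {u : α → ℝ}
    (q : ι → α → Prop) [∀ k, DecidablePred (q k)] (hu : ∀ x ∈ s, 0 ≤ u x)
    (hq : ∀ x ∈ s, ∃ k ∈ T, q k x) :
    ∑ x ∈ s, u x ≤ ∑ k ∈ T, ∑ x ∈ s.filter (q k), u x := by
  simp only [Finset.sum_filter]
  rw [Finset.sum_comm]
  refine Finset.sum_le_sum fun x hx => ?_
  obtain ⟨k, hk, hqk⟩ := hq x hx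
  calc u x = if q k x then u x else 0 := by rw [if_pos hqk]
    _ ≤ ∑ k ∈ T, if q k x then u x else 0 :=
      Finset.single_le_sum (f := fun k => if q k x then u x else 0)
        (fun i _ => by split_ifs; exacts [hu x hx, le_rfl]) hk

/-! ### Reflections of walks -/

/-- Reflection of the lattice in the hyperplane on which the coordinate `e` equals `c`. -/
def flip {d : ℕ} (e : Fin d) (c : ℤ) (x : Fin d → ℤ) : Fin d → ℤ :=
  x + Pi.single e (2 * (c - x e))

theorem flip_same {d : ℕ} (e : Fin d) (c : ℤ) (x : Fin d → ℤ) : flip e c x e = 2 * c - x e := by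
  simp only [flip, Pi.add_apply, Pi.single_eq_same]
  ring

theorem flip_ne {d : ℕ} {e k : Fin d} (hk : k ≠ e) (c : ℤ) (x : Fin d → ℤ) :
    flip e c x k = x k := by
  simp [flip, hk]

theorem flip_flip {d : ℕ} (e : Fin d) (c : ℤ) (x : Fin d → ℤ) : flip e c (flip e c x) = x := by
  funext k
  by_cases hk : k = e
  · subst hk
    rw [flip_same, flip_same]
    ring
  · rw [flip_ne hk, flip_ne hk]

theorem flip_injective {d : ℕ} (e : Fin d) (c : ℤ) : Function.Injective (flip e c) :=
  (show Function.Involutive (flip e c) from flip_flip e c).injective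

theorem flip_self {d : ℕ} (e : Fin d) (x : Fin d → ℤ) : flip e (x e) x = x := by
  simp [flip]

theorem adj_flip {d : ℕ} (e : Fin d) (c : ℤ) {x y : Fin d → ℤ} (hxy : (lattice d).Adj x y) :
    (lattice d).Adj (flip e c x) (flip e c y) := by
  have hxy : ∑ i, |x i - y i| = 1 := hxy
  change ∑ i, |flip e c x i - flip e c y i| = 1
  rw [← hxy]
  refine Finset.sum_congr rfl fun k _ => ?_
  by_cases hk : k = e
  · subst hk
    rw [flip_same, flip_same, ← abs_neg]
    congr 1
    ring
  · rw [flip_ne hk, flip_ne hk]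

theorem adj_sub {d : ℕ} {x y : Fin d → ℤ} (z : Fin d → ℤ) (hxy : (lattice d).Adj x y) :
    (lattice d).Adj (x - z) (y - z) := by
  have hxy : ∑ i, |x i - y i| = 1 := hxy
  change ∑ i, |(x - z) i - (y - z) i| = 1
  simpa using hxy

theorem adj_add {d : ℕ} {x y : Fin d → ℤ} (z : Fin d → ℤ) (hxy : (lattice d).Adj x y) :
    (lattice d).Adj (z + x) (z + y) := by
  have hxy : ∑ i, |x i - y i| = 1 := hxy
  change ∑ i, |(z + x) i - (z + y) i| = 1
  simpa using hxy

theorem map_flip {d : ℕ} {h : (Fin d → ℤ) →+ ℤ} {e : Fin d} (hh : ∀ k, h (Pi.single e k) = 0)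
    (c : ℤ) (x : Fin d → ℤ) : h (flip e c x) = h x := by
  rw [flip, map_add, hh, add_zero]

/-- Reflection of the part of a walk after time `j`, in the hyperplane through its position at
time `j`. -/
def fold {d : ℕ} (e : Fin d) (j : ℕ) (w : ℕ → Fin d → ℤ) (i : ℕ) : Fin d → ℤ :=
  if i ≤ j then w i else flip e (w j e) (w i)

theorem fold_of_le {d : ℕ} (e : Fin d) {i j : ℕ} (hij : i ≤ j) (w : ℕ → Fin d → ℤ) :
    fold e j w i = w i := if_pos hij

theorem fold_of_lt {d : ℕ} (e : Fin d) {i j : ℕ} (hij : j < i) (w : ℕ → Fin d → ℤ) :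
    fold e j w i = flip e (w j e) (w i) := if_neg (by omega)

theorem fold_eq_flip_of_ge {d : ℕ} (e : Fin d) {i j : ℕ} (hij : j ≤ i) (w : ℕ → Fin d → ℤ) :
    fold e j w i = flip e (w j e) (w i) := by
  rcases hij.eq_or_lt with rfl | h
  · rw [fold_of_le e le_rfl, flip_self]
  · exact fold_of_lt e h w

theorem fold_fold {d : ℕ} (e : Fin d) (j : ℕ) (w : ℕ → Fin d → ℤ) :
    fold e j (fold e j w) = w := by
  funext i
  rcases le_or_gt i j with h | h
  · rw [fold_of_le e h, fold_of_le e h]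
  · rw [fold_of_lt e h, fold_of_lt e h, fold_of_le e le_rfl, flip_flip]

theorem fold_injective {d : ℕ} (e : Fin d) (j : ℕ) : Function.Injective (fold (d := d) e j) :=
  (show Function.Involutive (fold (d := d) e j) from fold_fold e j).injective

theorem map_fold {d : ℕ} {h : (Fin d → ℤ) →+ ℤ} {e : Fin d} (hh : ∀ k, h (Pi.single e k) = 0)
    (j : ℕ) (w : ℕ → Fin d → ℤ) (i : ℕ) : h (fold e j w i) = h (w i) := by
  unfold fold
  split_ifs
  exacts [rfl, map_flip hh _ _]

theorem weight_fold {d : ℕ} {h : (Fin d → ℤ) →+ ℤ} {e : Fin d}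
    (hh : ∀ k, h (Pi.single e k) = 0) (a : ℝ) (n j : ℕ) (w : ℕ → Fin d → ℤ) :
    weight h a n (fold e j w) = weight h a n w := by
  simp only [weight, map_fold hh]

/-- Folding at the last time `j` at which the coordinate `e` is maximal preserves
self-avoidance: the two parts end up on different sides of a hyperplane. -/
theorem IsSAW.fold {d n : ℕ} {w : ℕ → Fin d → ℤ} (hw : IsSAW n w) {e : Fin d} {j : ℕ}
    (hj : j ≤ n) (hle : ∀ i ≤ j, w i e ≤ w j e) (hlt : ∀ i, j < i → i ≤ n → w i e < w j e) :
    IsSAW n (AdsorbingWalk.fold e j w) where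
  zero := by rw [fold_of_le e (Nat.zero_le j), hw.zero]
  adj i hi := by
    rcases lt_or_ge i j with h | h
    · rw [fold_of_le e h.le, fold_of_le e h]
      exact hw.adj i hi
    · rw [fold_eq_flip_of_ge e h, fold_eq_flip_of_ge e (by omega)]
      exact adj_flip e _ (hw.adj i hi)
  ne i k hik hk heq := by
    rcases le_or_gt k j with h | h
    · rw [fold_of_le e h, fold_of_le e (by omega)] at heq
      exact hw.ne i k hik hk heq
    · rcases le_or_gt i j with h' | h'
      · have := congrFun heq e
        rw [fold_of_le e h', fold_of_lt e h, flip_same] at this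
        linarith [hle i h', hlt k h hk]
      · rw [fold_of_lt e h, fold_of_lt e h'] at heq
        exact hw.ne i k hik hk (flip_injective e _ heq)
  constant i hi := by
    rw [fold_eq_flip_of_ge e hj, fold_eq_flip_of_ge e (hj.trans hi), hw.constant i hi]

/-! ### Unfolding a walk with few reflections -/

theorem exists_last_max (f : ℕ → ℤ) (n : ℕ) :
    ∃ j ≤ n, (∀ i ≤ n, f i ≤ f j) ∧ ∀ i, j < i → i ≤ n → f i < f j := by
  induction n with
  | zero => exact ⟨0, le_rfl, fun i hi => by rw [Nat.le_zero.1 hi], fun i h1 h2 => by omega⟩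
  | succ n ih =>
    obtain ⟨j, hj, h1, h2⟩ := ih
    rcases le_or_gt (f j) (f (n + 1)) with h | h
    · refine ⟨n + 1, le_rfl, fun i hi => ?_, fun i h3 h4 => by omega⟩
      rcases Nat.le_succ_iff.1 hi with h3 | rfl
      exacts [(h1 i h3).trans h, le_rfl]
    · refine ⟨j, by omega, fun i hi => ?_, fun i h3 h4 => ?_⟩
      · rcases Nat.le_succ_iff.1 hi with h3 | rfl
        exacts [h1 i h3, h.le]
      · rcases Nat.le_succ_iff.1 h4 with h5 | rfl
        exacts [h2 i h3 h5, h]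

/-- The result of folding successively at the times listed in `l`. -/
def foldAll {d : ℕ} (e : Fin d) (l : List ℕ) (w : ℕ → Fin d → ℤ) : ℕ → Fin d → ℤ :=
  l.foldl (fun w j => fold e j w) w

theorem map_foldAll {d : ℕ} {h : (Fin d → ℤ) →+ ℤ} {e : Fin d}
    (hh : ∀ k, h (Pi.single e k) = 0) (l : List ℕ) (w : ℕ → Fin d → ℤ) (i : ℕ) :
    h (foldAll e l w i) = h (w i) := by
  induction l generalizing w with
  | nil => rfl
  | cons j l ih => exact (ih _).trans (map_fold hh j w i)

/-- The induction behind `IsSAW.exists_foldAll`. After time `s` the walk stays strictly beyond its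
position at time `s`, by at most `E`. Each fold at the last maximum strictly decreases the excess
that remains, and an excess `E` takes at least `E` steps to build up; the number `m` of folds
therefore satisfies `m * (m + 1) / 2 ≤ n - s`. -/
theorem IsSAW.exists_foldAll_aux {d n : ℕ} (e : Fin d) (E : ℕ) : ∀ (w : ℕ → Fin d → ℤ) (s : ℕ),
    IsSAW n w → s ≤ n → (∀ i ≤ s, w i e ≤ w s e) → (∀ i, s < i → i ≤ n → w s e < w i e) →
    (∀ i, w i e ≤ w s e + E) →
    ∃ l : List ℕ, l.length ≤ E ∧ l.length * (l.length + 1) + 2 * s ≤ 2 * n ∧ (∀ j ∈ l, j ≤ n) ∧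
      IsSAW n (foldAll e l w) ∧ (∀ i, foldAll e l w i e ≤ foldAll e l w n e) ∧
      ((∀ i, 0 ≤ w i e) → ∀ i, 0 ≤ foldAll e l w i e) := by
  induction E using Nat.strong_induction_on with
  | _ E ih =>
    intro w s hw hs hle hlt hE
    obtain ⟨j, hjn, hj1, hj2⟩ := exists_last_max (fun i => w i e) n
    have hmax : ∀ i, w i e ≤ w j e := fun i => by
      rcases le_total i n with h | h
      · exact hj1 i h
      · rw [hw.constant i h]
        exact hj1 n le_rfl
    rcases hjn.eq_or_lt with rfl | hjn'
    · exact ⟨[], by simp, by simpa using hs, by simp, hw, hmax, fun h => h⟩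
    have hsj : s < j := by
      by_contra hcon
      have h1 := hle j (by omega)
      have h2 : w n e < w j e := hj2 n hjn' le_rfl
      rcases hs.eq_or_lt with rfl | h
      · omega
      · have h3 := hlt n h le_rfl
        omega
    have hgap := hlt j hsj hjn
    have hlen := hw.sub_le e s (j - s) (by omega)
    rw [Nat.add_sub_cancel' hsj.le] at hlen
    obtain ⟨l, hl1, hl2, hl3, hl4, hl5, hl6⟩ := ih (w j e - w s e - 1).toNat
      (by have := hE j; omega) (AdsorbingWalk.fold e j w) j
      (hw.fold hjn (fun i hi => hmax i) hj2) hjn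
      (fun i hi => by rw [fold_of_le e hi, fold_of_le e le_rfl]; exact hmax i)
      (fun i hi hin => by
        rw [fold_of_lt e hi, fold_of_le e le_rfl, flip_same]
        have : w i e < w j e := hj2 i hi hin
        omega)
      (fun i => by
        rw [fold_of_le e le_rfl]
        rcases le_or_gt i j with h | h
        · rw [fold_of_le e h]
          have := hmax i
          omega
        · rw [fold_of_lt e h, flip_same]
          have : w s e < w i e := by
            rcases le_total i n with h' | h'
            · exact hlt i (by omega) h'
            · rw [hw.constant i h']
              exact hlt n (by omega) le_rfl
          omega)
    refine ⟨j :: l, ?_, ?_, ?_, hl4, hl5, fun h0 => hl6 fun i => ?_⟩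
    · have := hE j
      rw [List.length_cons]
      omega
    · have h1 : l.length + 1 ≤ j - s := by omega
      rw [List.length_cons]
      nlinarith [Nat.sub_add_cancel hsj.le]
    · intro i hi
      rcases List.mem_cons.1 hi with rfl | hi
      exacts [hjn, hl3 i hi]
    · rcases le_or_gt i j with h | h
      · rw [fold_of_le e h]
        exact h0 i
      · rw [fold_of_lt e h, flip_same]
        linarith [hmax i, h0 i, h0 j]

/-- The unfolding of Hammersley and Welsh: every `n`-step self-avoiding walk becomes, after `O(√n)`
folds, a self-avoiding walk on which the coordinate `e` is maximal at the end. -/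
theorem IsSAW.exists_foldAll {d n : ℕ} (e : Fin d) {w : ℕ → Fin d → ℤ} (hw : IsSAW n w) :
    ∃ l : List ℕ, l.length ≤ Nat.sqrt (2 * n) + 1 ∧ (∀ j ∈ l, j ≤ n) ∧
      IsSAW n (foldAll e l w) ∧ (∀ i, foldAll e l w i e ≤ foldAll e l w n e) ∧
      ((∀ i, 0 ≤ w i e) → ∀ i, 0 ≤ foldAll e l w i e) := by
  obtain ⟨j, hjn, hj1, hj2⟩ := exists_last_max (fun i => w i e) n
  have hmax : ∀ i, w i e ≤ w j e := fun i => by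
    rcases le_total i n with h | h
    · exact hj1 i h
    · rw [hw.constant i h]
      exact hj1 n le_rfl
  obtain ⟨k, hkn, hk, -⟩ := exists_last_max (fun i => -w i e) n
  have hmin : ∀ i, w k e ≤ w i e := fun i => by
    rcases le_total i n with h | h
    · exact neg_le_neg_iff.1 (hk i h)
    · rw [hw.constant i h]
      exact neg_le_neg_iff.1 (hk n le_rfl)
  obtain ⟨l, -, hl2, hl3, hl4, hl5, hl6⟩ := IsSAW.exists_foldAll_aux e (w j e - w k e).toNat
    (AdsorbingWalk.fold e j w) j (hw.fold hjn (fun i _ => hmax i) hj2) hjn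
    (fun i hi => by rw [fold_of_le e hi, fold_of_le e le_rfl]; exact hmax i)
    (fun i hi hin => by
      rw [fold_of_lt e hi, fold_of_le e le_rfl, flip_same]
      have : w i e < w j e := hj2 i hi hin
      omega)
    (fun i => by
      rw [fold_of_le e le_rfl]
      have h1 := hmax i
      have h2 := hmin i
      rcases le_or_gt i j with h | h
      · rw [fold_of_le e h]
        omega
      · rw [fold_of_lt e h, flip_same]
        omega)
  refine ⟨j :: l, ?_, ?_, hl4, hl5, fun h0 => hl6 fun i => ?_⟩
  · rw [List.length_cons, Nat.add_le_add_iff_right, Nat.le_sqrt]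
    nlinarith
  · intro i hi
    rcases List.mem_cons.1 hi with rfl | hi
    exacts [hjn, hl3 i hi]
  · rcases le_or_gt i j with h | h
    · rw [fold_of_le e h]
      exact h0 i
    · rw [fold_of_lt e h, flip_same]
      linarith [hmax i, h0 i, h0 j]

/-- Folding at a prescribed time is injective, so walks that become elements of `B` after at most
`k` folds are outweighed by `B` up to the number of lists of fold times. -/
theorem sum_weight_le_of_foldAll {d : ℕ} {h : (Fin d → ℤ) →+ ℤ} {e : Fin d}
    (hh : ∀ k, h (Pi.single e k) = 0) {a : ℝ} (ha : 0 < a) (n : ℕ)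
    (B : Finset (ℕ → Fin d → ℤ)) (k : ℕ) : ∀ S : Finset (ℕ → Fin d → ℤ),
    (∀ w ∈ S, ∃ l : List ℕ, l.length ≤ k ∧ (∀ j ∈ l, j ≤ n) ∧ foldAll e l w ∈ B) →
    ∑ w ∈ S, weight h a n w ≤ ((n : ℝ) + 2) ^ k * ∑ w ∈ B, weight h a n w := by
  classical
  have hw0 : ∀ w, 0 ≤ weight h a n w := fun w => (weight_pos h ha n w).le
  induction k with
  | zero =>
    intro S hS
    rw [pow_zero, one_mul]
    refine Finset.sum_le_sum_of_subset_of_nonneg (fun w hw => ?_) fun w _ _ => hw0 w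
    obtain ⟨l, hl, -, hlB⟩ := hS w hw
    rw [List.length_eq_zero_iff.1 (Nat.le_zero.1 hl)] at hlB
    exact hlB
  | succ k ih =>
    intro S hS
    set Z := ∑ w ∈ B, weight h a n w with hZ
    have hZ0 : 0 ≤ Z := Finset.sum_nonneg fun w _ => hw0 w
    -- time `j + 1` encodes a first fold at time `j`, and `0` encodes the empty list
    let q : ℕ → (ℕ → Fin d → ℤ) → Prop := fun t w =>
      (t = 0 ∧ w ∈ B) ∨ ∃ j, t = j + 1 ∧
        ∃ l : List ℕ, l.length ≤ k ∧ (∀ i ∈ l, i ≤ n) ∧ foldAll e l (fold e j w) ∈ B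
    have hq : ∀ w ∈ S, ∃ t ∈ Finset.range (n + 2), q t w := by
      intro w hw
      obtain ⟨l, hl, hln, hlB⟩ := hS w hw
      cases l with
      | nil => exact ⟨0, by simp, Or.inl ⟨rfl, hlB⟩⟩
      | cons j l =>
        refine ⟨j + 1, ?_, Or.inr ⟨j, rfl, l, by simpa using hl, fun i hi =>
          hln i (List.mem_cons_of_mem _ hi), hlB⟩⟩
        have := hln j List.mem_cons_self
        rw [Finset.mem_range]
        omega
    have hpow : (1 : ℝ) ≤ ((n : ℝ) + 2) ^ k := one_le_pow₀ (by linarith [n.cast_nonneg (α := ℝ)])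
    have hterm : ∀ t ∈ Finset.range (n + 2),
        ∑ w ∈ S.filter (q t), weight h a n w ≤ ((n : ℝ) + 2) ^ k * Z := by
      intro t _
      cases t with
      | zero =>
        refine (Finset.sum_le_sum_of_subset_of_nonneg (fun w hw => ?_) fun w _ _ => hw0 w).trans
          (le_mul_of_one_le_left hZ0 hpow)
        rcases (Finset.mem_filter.1 hw).2 with h1 | ⟨j, h1, -⟩
        exacts [h1.2, by omega]
      | succ j =>
        rw [Finset.sum_congr rfl fun w _ => (weight_fold hh a n j w).symm,
          ← Finset.sum_image (fun w _ w' _ hww => fold_injective e j hww)]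
        refine ih _ fun w hw => ?_
        obtain ⟨w, hw', rfl⟩ := Finset.mem_image.1 hw
        rcases (Finset.mem_filter.1 hw').2 with h1 | ⟨i, h1, h2⟩
        · omega
        · obtain rfl : j = i := by omega
          exact h2
    calc ∑ w ∈ S, weight h a n w
        ≤ ∑ t ∈ Finset.range (n + 2), ∑ w ∈ S.filter (q t), weight h a n w :=
          sum_le_sum_sum_filter q (fun w _ => hw0 w) hq
      _ ≤ ∑ t ∈ Finset.range (n + 2), ((n : ℝ) + 2) ^ k * Z := Finset.sum_le_sum hterm
      _ = ((n : ℝ) + 2) ^ (k + 1) * Z := by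
          rw [Finset.sum_const, Finset.card_range, nsmul_eq_mul]
          push_cast
          ring

/-! ### Loops and bridges -/

/-- The reversed walk, moved back to the origin and reflected so that the coordinate `e` is minimal
at the start if it was maximal at the end. -/
def reverse {d : ℕ} (e : Fin d) (n : ℕ) (w : ℕ → Fin d → ℤ) (i : ℕ) : Fin d → ℤ :=
  flip e 0 (w (n - i) - w n)

theorem flip_zero_sub {d : ℕ} (e : Fin d) (x y : Fin d → ℤ) :
    flip e 0 (x - y) = flip e 0 x - flip e 0 y := by
  funext k
  by_cases hk : k = e
  · subst hk
    simp only [flip_same, Pi.sub_apply]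
    ring
  · simp only [flip_ne hk, Pi.sub_apply]

theorem IsSAW.reverse {d n : ℕ} {w : ℕ → Fin d → ℤ} (hw : IsSAW n w) (e : Fin d) :
    IsSAW n (AdsorbingWalk.reverse e n w) where
  zero := by simp [AdsorbingWalk.reverse, flip]
  adj i hi := by
    have := hw.adj (n - (i + 1)) (by omega)
    rw [show n - (i + 1) + 1 = n - i by omega] at this
    exact adj_flip e 0 (adj_sub _ this.symm)
  ne i j hij hj heq := by
    have := sub_left_injective (flip_injective e 0 heq)
    exact hw.ne (n - j) (n - i) (by omega) (by omega) this.symm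
  constant i hi := by
    rw [AdsorbingWalk.reverse, AdsorbingWalk.reverse, Nat.sub_eq_zero_of_le hi, Nat.sub_self]

theorem IsSAW.reverse_reverse {d n : ℕ} {w : ℕ → Fin d → ℤ} (hw : IsSAW n w) (e : Fin d) :
    AdsorbingWalk.reverse e n (AdsorbingWalk.reverse e n w) = w := by
  refine ((hw.reverse e).reverse e).ext_of_le hw fun i hi => ?_
  simp only [AdsorbingWalk.reverse]
  rw [← flip_zero_sub, flip_flip, Nat.sub_self, hw.zero, Nat.sub_sub_self hi]
  abel

theorem mem_loops {d : ℕ} {h : (Fin d → ℤ) →+ ℤ} {n : ℕ} {w : ℕ → Fin d → ℤ} :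
    w ∈ loops h n ↔ IsSAW n w ∧ (∀ i, 0 ≤ h (w i)) ∧ h (w n) = 0 := by
  simp [loops]

theorem map_reverse {d : ℕ} {h : (Fin d → ℤ) →+ ℤ} {e : Fin d}
    (hh : ∀ k, h (Pi.single e k) = 0) {n : ℕ} {w : ℕ → Fin d → ℤ} (hw : h (w n) = 0) (i : ℕ) :
    h (reverse e n w i) = h (w (n - i)) := by
  rw [reverse, map_flip hh, map_sub, hw, sub_zero]

theorem reverse_mem_loops {d : ℕ} {h : (Fin d → ℤ) →+ ℤ} {e : Fin d}
    (hh : ∀ k, h (Pi.single e k) = 0) {n : ℕ} {w : ℕ → Fin d → ℤ} (hw : w ∈ loops h n) :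
    reverse e n w ∈ loops h n := by
  obtain ⟨h1, h2, h3⟩ := mem_loops.1 hw
  refine mem_loops.2 ⟨h1.reverse e, fun i => ?_, ?_⟩
  · rw [map_reverse hh h3]
    exact h2 _
  · rw [map_reverse hh h3, Nat.sub_self, h1.zero, map_zero]

theorem weight_reverse {d : ℕ} {h : (Fin d → ℤ) →+ ℤ} {e : Fin d}
    (hh : ∀ k, h (Pi.single e k) = 0) {a : ℝ} (ha : 0 < a) {n : ℕ} {w : ℕ → Fin d → ℤ}
    (hw : w ∈ loops h n) : weight h a n (reverse e n w) = weight h a n w := by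
  obtain ⟨h1, h2, h3⟩ := mem_loops.1 hw
  have key : weight h a n w * a =
      (∏ i ∈ Finset.range n, if h (w i) = 0 then a else 1) * a := by
    have e1 := Finset.prod_range_succ (fun i => if h (w i) = 0 then a else 1) n
    have e2 := Finset.prod_range_succ' (fun i => if h (w i) = 0 then a else 1) n
    rw [h3, if_pos rfl] at e1
    rw [h1.zero, map_zero, if_pos rfl] at e2
    rw [weight, ← e1, ← e2]
  rw [mul_right_cancel₀ ha.ne' key,
    ← Finset.prod_range_reflect (fun i => if h (w i) = 0 then a else 1)]
  refine Finset.prod_congr rfl fun i hi => ?_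
  rw [map_reverse hh h3, show n - (i + 1) = n - 1 - i by omega]

theorem foldAll_mem_loops {d : ℕ} {h : (Fin d → ℤ) →+ ℤ} {e : Fin d}
    (hh : ∀ k, h (Pi.single e k) = 0) {n : ℕ} {w : ℕ → Fin d → ℤ} (hw : w ∈ loops h n)
    {l : List ℕ} (hl : IsSAW n (foldAll e l w)) : foldAll e l w ∈ loops h n := by
  obtain ⟨-, h2, h3⟩ := mem_loops.1 hw
  exact mem_loops.2 ⟨hl, fun i => by rw [map_foldAll hh]; exact h2 i, by rw [map_foldAll hh, h3]⟩

theorem mem_bridges {d : ℕ} {h : (Fin d → ℤ) →+ ℤ} {e : Fin d} {n : ℕ} {w : ℕ → Fin d → ℤ} :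
    w ∈ bridges h e n ↔ w ∈ loops h n ∧ ∀ i, 0 ≤ w i e ∧ w i e ≤ w n e := by
  simp [bridges]

/-- A bound on the number of ways in which an `n`-step walk can be unfolded from one end. -/
noncomputable def foldBound (n : ℕ) : ℝ := ((n : ℝ) + 2) ^ (Nat.sqrt (2 * n) + 1)

/-- Unfolding from both ends turns loops into bridges. -/
theorem sum_loops_le {d : ℕ} {h : (Fin d → ℤ) →+ ℤ} {e : Fin d}
    (hh : ∀ k, h (Pi.single e k) = 0) {a : ℝ} (ha : 0 < a) (n : ℕ) :
    ∑ w ∈ loops h n, weight h a n w ≤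
      foldBound n ^ 2 * ∑ w ∈ bridges h e n, weight h a n w := by
  classical
  have hw0 : ∀ w, 0 ≤ weight h a n w := fun w => (weight_pos h ha n w).le
  have hK : 0 ≤ foldBound n := by unfold foldBound; positivity
  have step1 : ∑ w ∈ loops h n, weight h a n w ≤ foldBound n *
      ∑ w ∈ (loops h n).filter (fun w => ∀ i, w i e ≤ w n e), weight h a n w := by
    refine sum_weight_le_of_foldAll hh ha n _ _ _ fun w hw => ?_
    obtain ⟨l, hl1, hl2, hl3, hl4, -⟩ := (mem_loops.1 hw).1.exists_foldAll e
    exact ⟨l, hl1, hl2, Finset.mem_filter.2 ⟨foldAll_mem_loops hh hw hl3, hl4⟩⟩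
  have step2 : ∑ w ∈ (loops h n).filter (fun w => ∀ i, w i e ≤ w n e), weight h a n w ≤
      ∑ w ∈ (loops h n).filter (fun w => ∀ i, 0 ≤ w i e), weight h a n w := by
    refine sum_le_sum_of_injOn (reverse e n) (fun w hw => ?_) (fun w hw w' hw' heq => ?_)
      (fun w hw => ?_) fun w _ => hw0 w
    · obtain ⟨hw1, hw2⟩ := Finset.mem_filter.1 hw
      refine Finset.mem_filter.2 ⟨reverse_mem_loops hh hw1, fun i => ?_⟩
      rw [reverse, flip_same, Pi.sub_apply]
      linarith [hw2 (n - i)]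
    · rw [← (mem_loops.1 (Finset.mem_filter.1 hw).1).1.reverse_reverse e, heq,
        (mem_loops.1 (Finset.mem_filter.1 hw').1).1.reverse_reverse e]
    · rw [weight_reverse hh ha (Finset.mem_filter.1 hw).1]
  have step3 : ∑ w ∈ (loops h n).filter (fun w => ∀ i, 0 ≤ w i e), weight h a n w ≤
      foldBound n * ∑ w ∈ bridges h e n, weight h a n w := by
    refine sum_weight_le_of_foldAll hh ha n _ _ _ fun w hw => ?_
    obtain ⟨hw1, hw2⟩ := Finset.mem_filter.1 hw
    obtain ⟨l, hl1, hl2, hl3, hl4, hl5⟩ := (mem_loops.1 hw1).1.exists_foldAll e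
    exact ⟨l, hl1, hl2, mem_bridges.2 ⟨foldAll_mem_loops hh hw1 hl3, fun i =>
      ⟨hl5 hw2 i, hl4 i⟩⟩⟩
  calc _ ≤ foldBound n * _ := step1
    _ ≤ foldBound n * (foldBound n * ∑ w ∈ bridges h e n, weight h a n w) := by
        gcongr
        exact step2.trans step3
    _ = _ := by ring

/-! ### Cutting and gluing walks -/

/-- The concatenation of an `m`-step walk, one step in the direction `e`, and another walk. -/
def glue {d : ℕ} (e : Fin d) (m : ℕ) (f g : ℕ → Fin d → ℤ) (i : ℕ) : Fin d → ℤ :=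
  if i ≤ m then f i else f m + Pi.single e 1 + g (i - (m + 1))

theorem glue_of_le {d : ℕ} (e : Fin d) {m i : ℕ} (hi : i ≤ m) (f g : ℕ → Fin d → ℤ) :
    glue e m f g i = f i := if_pos hi

theorem glue_add {d : ℕ} (e : Fin d) (m i : ℕ) (f g : ℕ → Fin d → ℤ) :
    glue e m f g (m + 1 + i) = f m + Pi.single e 1 + g i := by
  rw [glue, if_neg (by omega), Nat.add_sub_cancel_left]

theorem adj_add_single {d : ℕ} (e : Fin d) (x : Fin d → ℤ) :
    (lattice d).Adj x (x + Pi.single e 1) := by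
  change ∑ i, |x i - (x + Pi.single e 1 : Fin d → ℤ) i| = 1
  rw [Finset.sum_eq_single e]
  · simp
  · intro i _ hi
    simp [hi]
  · simp

theorem IsSAW.glue {d m n : ℕ} {e : Fin d} {f g : ℕ → Fin d → ℤ} (hf : IsSAW m f)
    (hg : IsSAW n g) (hfe : ∀ i, f i e ≤ f m e) (hge : ∀ i, 0 ≤ g i e) :
    IsSAW (m + 1 + n) (AdsorbingWalk.glue e m f g) where
  zero := by rw [glue_of_le e (Nat.zero_le m), hf.zero]
  adj i hi := by
    rcases lt_trichotomy i m with h | rfl | h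
    · rw [glue_of_le e h.le, glue_of_le e h]
      exact hf.adj i h
    · rw [glue_of_le e le_rfl, ← add_zero (i + 1), glue_add, hg.zero, add_zero]
      exact adj_add_single e _
    · obtain ⟨k, rfl⟩ := Nat.exists_eq_add_of_le h
      rw [glue_add, add_assoc (m + 1), glue_add]
      exact adj_add _ (hg.adj k (by omega))
  ne i j hij hj heq := by
    rcases le_or_gt j m with h | h
    · rw [glue_of_le e h, glue_of_le e (by omega)] at heq
      exact hf.ne i j hij h heq
    · obtain ⟨k, rfl⟩ := Nat.exists_eq_add_of_le h
      rw [glue_add] at heq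
      rcases le_or_gt i m with h' | h'
      · rw [glue_of_le e h'] at heq
        have := congrFun heq e
        simp only [Pi.add_apply, Pi.single_eq_same] at this
        linarith [hfe i, hge k]
      · obtain ⟨l, rfl⟩ := Nat.exists_eq_add_of_le h'
        rw [glue_add] at heq
        exact hg.ne l k (by omega) (by omega) (add_left_cancel heq)
  constant i hi := by
    obtain ⟨k, rfl⟩ := Nat.exists_eq_add_of_le hi
    rw [add_assoc (m + 1), glue_add, glue_add, hg.constant _ (by omega)]

theorem IsSAW.glue_inj {d m : ℕ} {e : Fin d} {f g f' g' : ℕ → Fin d → ℤ} (hf : IsSAW m f)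
    (hf' : IsSAW m f') (heq : AdsorbingWalk.glue e m f g = AdsorbingWalk.glue e m f' g') :
    f = f' ∧ g = g' := by
  have hff : f = f' := hf.ext_of_le hf' fun i hi => by
    rw [← glue_of_le e hi f g, heq, glue_of_le e hi]
  refine ⟨hff, funext fun i => ?_⟩
  have := congrFun heq (m + 1 + i)
  rw [glue_add, glue_add, hff] at this
  exact add_left_cancel this

theorem glue_mem_bridges {d : ℕ} {h : (Fin d → ℤ) →+ ℤ} {e : Fin d}
    (hh : ∀ k, h (Pi.single e k) = 0) {m n : ℕ} {f g : ℕ → Fin d → ℤ}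
    (hf : f ∈ bridges h e m) (hg : g ∈ bridges h e n) :
    glue e m f g ∈ bridges h e (m + 1 + n) := by
  obtain ⟨hf1, hf2⟩ := mem_bridges.1 hf
  obtain ⟨hg1, hg2⟩ := mem_bridges.1 hg
  obtain ⟨hf3, hf4, hf5⟩ := mem_loops.1 hf1
  obtain ⟨hg3, hg4, hg5⟩ := mem_loops.1 hg1
  refine mem_bridges.2 ⟨mem_loops.2 ⟨hf3.glue hg3 (fun i => (hf2 i).2) (fun i => (hg2 i).1),
    fun i => ?_, ?_⟩, fun i => ?_⟩
  · rcases le_or_gt i m with hi | hi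
    · rw [glue_of_le e hi]
      exact hf4 i
    · obtain ⟨k, rfl⟩ := Nat.exists_eq_add_of_le hi
      rw [glue_add, map_add, map_add, hf5, hh, zero_add, zero_add]
      exact hg4 k
  · rw [glue_add, map_add, map_add, hf5, hh, hg5]
    rfl
  · rw [glue_add]
    have h0 := hf2 m
    have h1 := hg2 n
    rcases le_or_gt i m with hi | hi
    · rw [glue_of_le e hi]
      simp only [Pi.add_apply, Pi.single_eq_same]
      have := hf2 i
      constructor <;> linarith [this.1, this.2]
    · obtain ⟨k, rfl⟩ := Nat.exists_eq_add_of_le hi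
      rw [glue_add]
      simp only [Pi.add_apply, Pi.single_eq_same]
      have := hg2 k
      constructor <;> linarith [this.1, this.2]

theorem weight_glue {d : ℕ} {h : (Fin d → ℤ) →+ ℤ} {e : Fin d}
    (hh : ∀ k, h (Pi.single e k) = 0) (a : ℝ) {m n : ℕ} {f g : ℕ → Fin d → ℤ}
    (hf : h (f m) = 0) (hg : g 0 = 0) :
    weight h a (m + 1 + n) (glue e m f g) = weight h a m f * a * weight h a n g := by
  rw [weight, Finset.prod_range_add, Finset.prod_range_succ]
  congr 1
  · congr 1
    · refine Finset.prod_congr rfl fun i hi => ?_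
      rw [glue_of_le e (Finset.mem_range.1 hi)]
    · rw [← add_zero (m + 1), glue_add, map_add, map_add, hf, hh, hg, map_zero]
      exact if_pos rfl
  · refine Finset.prod_congr rfl fun i _ => ?_
    rw [add_assoc (m + 1), glue_add, map_add, map_add, hf, hh, zero_add, zero_add]

/-- The partition function of bridges. -/
noncomputable def bridgeSum {d : ℕ} (h : (Fin d → ℤ) →+ ℤ) (e : Fin d) (a : ℝ) (n : ℕ) : ℝ :=
  ∑ w ∈ bridges h e n, weight h a n w

theorem bridgeSum_mul_le {d : ℕ} {h : (Fin d → ℤ) →+ ℤ} {e : Fin d}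
    (hh : ∀ k, h (Pi.single e k) = 0) {a : ℝ} (ha : 0 < a) (m n : ℕ) :
    a * bridgeSum h e a m * bridgeSum h e a n ≤ bridgeSum h e a (m + 1 + n) := by
  have hsum : a * bridgeSum h e a m * bridgeSum h e a n =
      ∑ x ∈ bridges h e m ×ˢ bridges h e n, weight h a m x.1 * a * weight h a n x.2 := by
    rw [Finset.sum_product, bridgeSum, bridgeSum, mul_assoc, Finset.sum_mul_sum, Finset.mul_sum]
    refine Finset.sum_congr rfl fun f _ => ?_
    rw [Finset.mul_sum]
    exact Finset.sum_congr rfl fun g _ => by ring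
  rw [hsum]
  have hsaw : ∀ {k : ℕ} {w : ℕ → Fin d → ℤ}, w ∈ bridges h e k → IsSAW k w ∧ h (w k) = 0 :=
    fun hw => ⟨(mem_loops.1 (mem_bridges.1 hw).1).1, (mem_loops.1 (mem_bridges.1 hw).1).2.2⟩
  refine sum_le_sum_of_injOn (fun x => glue e m x.1 x.2) (fun x hx => ?_)
    (fun x hx y hy heq => ?_) (fun x hx => ?_) fun w _ => (weight_pos h ha _ w).le
  · exact glue_mem_bridges hh (Finset.mem_product.1 hx).1 (Finset.mem_product.1 hx).2
  · have := (hsaw (Finset.mem_product.1 hx).1).1.glue_inj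
      (hsaw (Finset.mem_product.1 hy).1).1 heq
    exact Prod.ext this.1 this.2
  · rw [weight_glue hh a (hsaw (Finset.mem_product.1 hx).1).2
      (hsaw (Finset.mem_product.1 hx).2).1.zero]

theorem isSAW_zero (d : ℕ) : IsSAW 0 (0 : ℕ → Fin d → ℤ) where
  zero := rfl
  adj i hi := by omega
  ne i j hij hj := by omega
  constant i hi := rfl

theorem bridgeSum_zero {d : ℕ} (h : (Fin d → ℤ) →+ ℤ) (e : Fin d) (a : ℝ) :
    bridgeSum h e a 0 = 1 := by
  have : bridges h e 0 = {0} := by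
    ext w
    rw [Finset.mem_singleton, mem_bridges, mem_loops]
    constructor
    · rintro ⟨⟨h1, -⟩, -⟩
      exact h1.ext_of_le (isSAW_zero d) fun i hi => by rw [Nat.le_zero.1 hi, h1.zero]; rfl
    · rintro rfl
      exact ⟨⟨isSAW_zero d, by simp, by simp⟩, by simp⟩
  rw [bridgeSum, this, Finset.sum_singleton, weight, Finset.prod_range_zero]

theorem pow_le_bridgeSum {d : ℕ} {h : (Fin d → ℤ) →+ ℤ} {e : Fin d}
    (hh : ∀ k, h (Pi.single e k) = 0) {a : ℝ} (ha : 0 < a) (n : ℕ) :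
    a ^ n ≤ bridgeSum h e a n := by
  induction n with
  | zero => rw [bridgeSum_zero, pow_zero]
  | succ n ih =>
    have := bridgeSum_mul_le hh ha n 0
    rw [bridgeSum_zero, mul_one] at this
    calc a ^ (n + 1) = a * a ^ n := pow_succ' a n
      _ ≤ a * bridgeSum h e a n := by gcongr
      _ ≤ _ := this

theorem IsSAW.take {d m n : ℕ} {w : ℕ → Fin d → ℤ} (hw : IsSAW (m + n) w) :
    IsSAW m fun i => w (min i m) where
  zero := by rw [Nat.zero_min, hw.zero]
  adj i hi := by
    rw [min_eq_left hi.le, min_eq_left (by omega)]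
    exact hw.adj i (by omega)
  ne i j hij hj := by
    rw [min_eq_left hj, min_eq_left (by omega)]
    exact hw.ne i j hij (by omega)
  constant i hi := by rw [min_eq_right hi, min_self]

theorem IsSAW.drop {d m n : ℕ} {w : ℕ → Fin d → ℤ} (hw : IsSAW (m + n) w) :
    IsSAW n fun i => w (m + i) - w m where
  zero := by simp
  adj i hi := adj_sub _ (hw.adj (m + i) (by omega))
  ne i j hij hj heq := hw.ne (m + i) (m + j) (by omega) (by omega) (sub_left_injective heq)
  constant i hi := by rw [hw.constant (m + i) (by omega)]

theorem take_drop_inj {d m : ℕ} {w w' : ℕ → Fin d → ℤ}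
    (h1 : (fun i => w (min i m)) = fun i => w' (min i m))
    (h2 : (fun i => w (m + i) - w m) = fun i => w' (m + i) - w' m) : w = w' := by
  have h3 : ∀ i ≤ m, w i = w' i := fun i hi => by
    have := congrFun h1 i
    simpa only [min_eq_left hi] using this
  funext i
  rcases le_total i m with hi | hi
  · exact h3 i hi
  · obtain ⟨k, rfl⟩ := Nat.exists_eq_add_of_le hi
    have := congrFun h2 k
    simp only [h3 m le_rfl] at this
    exact sub_left_injective this

/-- The number of self-avoiding walks, as a real number. -/
noncomputable def sawCount (d n : ℕ) : ℝ := ((saws d n).card : ℝ)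

theorem sawCount_add_le (d m n : ℕ) : sawCount d (m + n) ≤ sawCount d m * sawCount d n := by
  unfold sawCount
  norm_cast
  rw [← Finset.card_product]
  refine Finset.card_le_card_of_injOn
    (fun w => (fun i => w (min i m), fun i => w (m + i) - w m)) (fun w hw => ?_)
    fun w _ w' _ heq => take_drop_inj (congrArg Prod.fst heq) (congrArg Prod.snd heq)
  have hw := mem_saws.1 hw
  exact Finset.mem_product.2 ⟨mem_saws.2 hw.take, mem_saws.2 hw.drop⟩

/-- The partition function of positive walks. -/
noncomputable def positiveSum {d : ℕ} (h : (Fin d → ℤ) →+ ℤ) (a : ℝ) (n : ℕ) : ℝ :=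
  ∑ w ∈ positiveSaws h n, weight h a n w

theorem mem_positiveSaws {d : ℕ} {h : (Fin d → ℤ) →+ ℤ} {n : ℕ} {w : ℕ → Fin d → ℤ} :
    w ∈ positiveSaws h n ↔ IsSAW n w ∧ ∀ i, 0 ≤ h (w i) := by
  simp [positiveSaws]

/-- Cutting a positive walk at its last visit leaves a loop, which carries the whole weight, and
a self-avoiding walk. -/
theorem positiveSum_le {d : ℕ} (h : (Fin d → ℤ) →+ ℤ) {a : ℝ} (ha : 0 < a) (n : ℕ) :
    positiveSum h a n ≤ ∑ k ∈ Finset.range (n + 1),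
      (∑ w ∈ loops h k, weight h a k w) * sawCount d (n - k) := by
  classical
  let q : ℕ → (ℕ → Fin d → ℤ) → Prop := fun k w =>
    h (w k) = 0 ∧ ∀ i, k < i → i ≤ n → h (w i) ≠ 0
  have hq : ∀ w ∈ positiveSaws h n, ∃ k ∈ Finset.range (n + 1), q k w := by
    intro w hw
    have h0 : h (w 0) = 0 := by rw [(mem_positiveSaws.1 hw).1.zero, map_zero]
    refine ⟨Nat.findGreatest (fun i => h (w i) = 0) n, ?_, ?_, ?_⟩
    · rw [Finset.mem_range]
      exact Nat.lt_succ_of_le (Nat.findGreatest_le n)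
    · exact Nat.findGreatest_spec (P := fun i => h (w i) = 0) (Nat.zero_le n) h0
    · intro i hi hin
      exact Nat.findGreatest_is_greatest hi hin
  refine (sum_le_sum_sum_filter q (fun w _ => (weight_pos h ha n w).le) hq).trans
    (Finset.sum_le_sum fun k hk => ?_)
  obtain ⟨r, rfl⟩ := Nat.exists_eq_add_of_le (Nat.lt_succ_iff.1 (Finset.mem_range.1 hk))
  rw [Nat.add_sub_cancel_left]
  have hsum : (∑ w ∈ loops h k, weight h a k w) * sawCount d r =
      ∑ x ∈ loops h k ×ˢ saws d r, weight h a k x.1 := by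
    rw [Finset.sum_product, Finset.sum_mul]
    refine Finset.sum_congr rfl fun f _ => ?_
    simp only [Finset.sum_const, nsmul_eq_mul, sawCount]
    exact mul_comm _ _
  rw [hsum]
  refine sum_le_sum_of_injOn
    (fun w => (fun i => w (min i k), fun i => w (k + i) - w k)) (fun w hw => ?_)
    (fun w _ w' _ heq => take_drop_inj (congrArg Prod.fst heq) (congrArg Prod.snd heq))
    (fun w hw => ?_) fun x _ => (weight_pos h ha _ _).le
  · obtain ⟨hw1, hw2, -⟩ := Finset.mem_filter.1 hw
    obtain ⟨hw3, hw4⟩ := mem_positiveSaws.1 hw1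
    refine Finset.mem_product.2 ⟨mem_loops.2 ⟨hw3.take, fun i => hw4 _, ?_⟩,
      mem_saws.2 hw3.drop⟩
    simpa only [min_self] using hw2
  · obtain ⟨-, -, hw2⟩ := Finset.mem_filter.1 hw
    rw [weight, Finset.prod_range_add]
    rw [Finset.prod_eq_one (s := Finset.range r) fun i hi => if_neg (hw2 _ (by omega) (by
      have := Finset.mem_range.1 hi
      omega)), mul_one]
    refine (Finset.prod_congr rfl fun i hi => ?_).le
    simp only [min_eq_left (Nat.succ_le_of_lt (Finset.mem_range.1 hi))]

theorem bridgeSum_le_positiveSum {d : ℕ} (h : (Fin d → ℤ) →+ ℤ) (e : Fin d) {a : ℝ} (ha : 0 < a)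
    (n : ℕ) : bridgeSum h e a n ≤ positiveSum h a n := by
  refine Finset.sum_le_sum_of_subset_of_nonneg (fun w hw => ?_)
    fun w _ _ => (weight_pos h ha n w).le
  obtain ⟨h1, h2, -⟩ := mem_loops.1 (mem_bridges.1 hw).1
  exact mem_positiveSaws.2 ⟨h1, h2⟩

theorem weight_zero_one {d : ℕ} (n : ℕ) (w : ℕ → Fin d → ℤ) :
    weight (0 : (Fin d → ℤ) →+ ℤ) 1 n w = 1 := by
  simp [weight]

/-- A bridge in the vertical direction, lifted by one step, is a positive walk without visits. -/
theorem bridgeSum_one_le_positiveSum {d : ℕ} {h : (Fin d → ℤ) →+ ℤ} {e : Fin d}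
    (hhe : ∀ x, h x = x e) {a : ℝ} (ha : 0 < a) (n : ℕ) :
    bridgeSum 0 e 1 n ≤ positiveSum h a (n + 1) := by
  rw [add_comm n 1]
  have hh1 : ∀ {g : ℕ → Fin d → ℤ}, g ∈ bridges 0 e n → ∀ i,
      0 < h (glue e 0 0 g (0 + 1 + i)) := by
    intro g hg i
    rw [hhe, glue_add]
    have := ((mem_bridges.1 hg).2 i).1
    simp only [Pi.add_apply, Pi.single_eq_same, Pi.zero_apply]
    linarith
  refine sum_le_sum_of_injOn (glue e 0 0) (fun g hg => ?_)
    (fun g hg g' hg' heq => ((isSAW_zero d).glue_inj (isSAW_zero d) heq).2)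
    (fun g hg => ?_) fun w _ => (weight_pos h ha _ w).le
  · rw [← zero_add 1]
    refine mem_positiveSaws.2 ⟨(isSAW_zero d).glue (mem_loops.1 (mem_bridges.1 hg).1).1
      (fun i => le_rfl) (fun i => ((mem_bridges.1 hg).2 i).1), fun i => ?_⟩
    rcases Nat.eq_zero_or_pos i with rfl | hi
    · rw [glue_of_le e le_rfl]
      simp
    · obtain ⟨k, rfl⟩ := Nat.exists_eq_add_of_le (show 0 + 1 ≤ i by omega)
      exact (hh1 hg k).le
  · rw [weight_zero_one, weight, Finset.prod_eq_one]
    intro i _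
    have := hh1 hg i
    rw [zero_add, add_comm 1 i] at this
    exact if_neg this.ne'

theorem saws_eq_loops (d n : ℕ) : saws d n = loops 0 n := by
  ext w
  simp [mem_loops]

/-- Up to a subexponential factor, self-avoiding walks are as many as bridges. -/
theorem sawCount_le {d : ℕ} (e : Fin d) (n : ℕ) :
    sawCount d n ≤ foldBound n ^ 2 * bridgeSum 0 e 1 n := by
  have := sum_loops_le (h := 0) (e := e) (fun _ => rfl) one_pos n
  rw [← saws_eq_loops, Finset.sum_congr rfl fun w _ => weight_zero_one n w] at this
  simpa [sawCount, bridgeSum] using this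

theorem positiveSum_le_sawCount {d : ℕ} (h : (Fin d → ℤ) →+ ℤ) {a : ℝ} (ha : 0 < a) (n : ℕ) :
    positiveSum h a n ≤ max a 1 ^ n * sawCount d n := by
  calc positiveSum h a n ≤ ∑ w ∈ positiveSaws h n, max a 1 ^ n :=
        Finset.sum_le_sum fun w _ => weight_le h ha n w
    _ ≤ ∑ w ∈ saws d n, max a 1 ^ n := Finset.sum_le_sum_of_subset_of_nonneg
        (fun w hw => mem_saws.2 (mem_positiveSaws.1 hw).1) fun w _ _ => by positivity
    _ = max a 1 ^ n * sawCount d n := by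
        rw [Finset.sum_const, nsmul_eq_mul, mul_comm, sawCount]

/-! ### Exponential growth of the partition functions -/

theorem one_le_foldBound (n : ℕ) : 1 ≤ foldBound n :=
  one_le_pow₀ (by linarith [n.cast_nonneg (α := ℝ)])

theorem foldBound_mono {k n : ℕ} (hkn : k ≤ n) : foldBound k ≤ foldBound n := by
  have h1 : (k : ℝ) ≤ n := by exact_mod_cast hkn
  have h2 : Nat.sqrt (2 * k) ≤ Nat.sqrt (2 * n) := Nat.sqrt_le_sqrt (by omega)
  unfold foldBound
  calc ((k : ℝ) + 2) ^ (Nat.sqrt (2 * k) + 1) ≤ ((n : ℝ) + 2) ^ (Nat.sqrt (2 * k) + 1) := by gcongr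
    _ ≤ _ := pow_le_pow_right₀ (by linarith [n.cast_nonneg (α := ℝ)]) (by omega)

theorem tendsto_log_foldBound :
    Tendsto (fun n : ℕ => 1 / (n : ℝ) * Real.log (foldBound n)) atTop (𝓝 0) := by
  have h1 : Tendsto (fun n : ℕ => 9 * (Real.log ((n : ℝ) + 2) / ((n : ℝ) + 2) ^ (1 / 2 : ℝ)))
      atTop (𝓝 0) := by
    have := (isLittleO_log_rpow_atTop (show (0 : ℝ) < 1 / 2 by norm_num)).tendsto_div_nhds_zero.comp
      (tendsto_atTop_add_const_right _ (2 : ℝ) tendsto_natCast_atTop_atTop)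
    simpa using this.const_mul 9
  refine squeeze_zero' (Eventually.of_forall fun n => ?_) ?_ h1
  · exact mul_nonneg (by positivity) (Real.log_nonneg (one_le_foldBound n))
  · filter_upwards [eventually_ge_atTop 1] with n hn
    have hn' : (1 : ℝ) ≤ n := by exact_mod_cast hn
    have hl : 0 ≤ Real.log ((n : ℝ) + 2) := Real.log_nonneg (by linarith)
    rw [foldBound, Real.log_pow, ← Real.sqrt_eq_rpow]
    set y := Real.sqrt ((n : ℝ) + 2) with hy
    have hy2 : y * y = (n : ℝ) + 2 := Real.mul_self_sqrt (by linarith)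
    have hy0 : 0 < y := Real.sqrt_pos.2 (by linarith)
    have hs : ((Nat.sqrt (2 * n) + 1 : ℕ) : ℝ) ≤ 3 * y := by
      have h2 : ((Nat.sqrt (2 * n) : ℕ) : ℝ) * (Nat.sqrt (2 * n) : ℕ) ≤ 2 * n := by
        exact_mod_cast Nat.sqrt_le (2 * n)
      have h3 : ((Nat.sqrt (2 * n) : ℕ) : ℝ) ≤ 2 * y := by
        by_contra hcon
        push Not at hcon
        nlinarith
      have h4 : 1 ≤ y := by nlinarith
      push_cast
      linarith
    rw [one_div, inv_mul_le_iff₀ (by linarith)]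
    calc ((Nat.sqrt (2 * n) + 1 : ℕ) : ℝ) * Real.log ((n : ℝ) + 2)
        ≤ 3 * y * Real.log ((n : ℝ) + 2) := by gcongr
      _ = 3 * (y * y) * (Real.log ((n : ℝ) + 2) / y) := by field_simp
      _ ≤ (n : ℝ) * 9 * (Real.log ((n : ℝ) + 2) / y) := by
          refine mul_le_mul_of_nonneg_right ?_ (by positivity)
          linarith
      _ = (n : ℝ) * (9 * (Real.log ((n : ℝ) + 2) / y)) := by ring

theorem bridgeSum_pos {d : ℕ} {h : (Fin d → ℤ) →+ ℤ} {e : Fin d}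
    (hh : ∀ k, h (Pi.single e k) = 0) {a : ℝ} (ha : 0 < a) (n : ℕ) : 0 < bridgeSum h e a n :=
  (pow_pos ha n).trans_le (pow_le_bridgeSum hh ha n)

theorem bridgeSum_le_sawCount {d : ℕ} (h : (Fin d → ℤ) →+ ℤ) (e : Fin d) {a : ℝ} (ha : 0 < a)
    (n : ℕ) : bridgeSum h e a n ≤ max a 1 ^ n * sawCount d n :=
  (bridgeSum_le_positiveSum h e ha n).trans (positiveSum_le_sawCount h ha n)

theorem one_le_sawCount {d : ℕ} (e : Fin d) (n : ℕ) : 1 ≤ sawCount d n := by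
  have h1 := pow_le_bridgeSum (h := 0) (e := e) (fun _ => rfl) one_pos n
  have h2 := bridgeSum_le_sawCount 0 e one_pos n
  simp only [one_pow, max_self, one_mul] at h1 h2
  exact h1.trans h2

theorem exists_tendsto_log_sawCount {d : ℕ} (e : Fin d) :
    ∃ κ, Tendsto (fun n : ℕ => 1 / (n : ℝ) * Real.log (sawCount d n)) atTop (𝓝 κ) := by
  have hpos : ∀ n, 0 < sawCount d n := fun n => one_pos.trans_le (one_le_sawCount e n)
  have hsub : Subadditive fun n => Real.log (sawCount d n) := fun m n => by
    rw [← Real.log_mul (hpos m).ne' (hpos n).ne']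
    exact Real.log_le_log (hpos _) (sawCount_add_le d m n)
  refine ⟨hsub.lim, ?_⟩
  simp only [one_div_mul_eq_div]
  refine hsub.tendsto_lim ⟨0, ?_⟩
  rintro _ ⟨n, rfl⟩
  exact div_nonneg (Real.log_nonneg (one_le_sawCount e n)) n.cast_nonneg

/-- Fekete's lemma applied to bridges: gluing costs one extra step, so the supermultiplicative
sequence is `n ↦ a * bridgeSum (n - 1)`, with value `1` at `n = 0`. -/
theorem exists_tendsto_log_bridgeSum {d : ℕ} {h : (Fin d → ℤ) →+ ℤ} {e : Fin d}
    (hh : ∀ k, h (Pi.single e k) = 0) {a : ℝ} (ha : 0 < a) :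
    ∃ l, Tendsto (fun n : ℕ => 1 / (n : ℝ) * Real.log (bridgeSum h e a n)) atTop (𝓝 l) := by
  obtain ⟨κ, hκ⟩ := exists_tendsto_log_sawCount e
  obtain ⟨B, hB0, hB⟩ := exists_le_const_mul_exp
    (fun n => one_pos.trans_le (one_le_sawCount e n)) hκ one_pos
  have hpos := bridgeSum_pos hh ha
  let u : ℕ → ℝ := fun n => if n = 0 then 0 else -Real.log (a * bridgeSum h e a (n - 1))
  have hu0 : u 0 = 0 := if_pos rfl
  have hu1 : ∀ n, u (n + 1) = -Real.log (a * bridgeSum h e a n) := fun n => if_neg n.succ_ne_zero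
  have hsub : Subadditive u := by
    intro m n
    cases m with
    | zero => rw [zero_add, hu0, zero_add]
    | succ m =>
      cases n with
      | zero => rw [add_zero, hu0, add_zero]
      | succ n =>
        rw [← add_assoc, hu1, hu1, hu1, ← neg_add, neg_le_neg_iff,
          ← Real.log_mul (mul_pos ha (hpos m)).ne' (mul_pos ha (hpos n)).ne']
        refine Real.log_le_log (by have := hpos m; have := hpos n; positivity) ?_
        have := bridgeSum_mul_le hh ha m n
        calc a * bridgeSum h e a m * (a * bridgeSum h e a n)
            = a * (a * bridgeSum h e a m * bridgeSum h e a n) := by ring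
          _ ≤ _ := by gcongr
  have hbdd : BddBelow (Set.range fun n => u n / n) := by
    refine ⟨-(|Real.log (a * B)| + |Real.log (max a 1) + (κ + 1)|), ?_⟩
    rintro _ ⟨n, rfl⟩
    cases n with
    | zero =>
      simp only [hu0, zero_div]
      have := abs_nonneg (Real.log (a * B))
      have := abs_nonneg (Real.log (max a 1) + (κ + 1))
      linarith
    | succ n =>
      have hn : (0 : ℝ) < ((n + 1 : ℕ) : ℝ) := by exact_mod_cast n.succ_pos
      have hle : a * bridgeSum h e a n ≤
          a * (max a 1 ^ n * (B * Real.exp ((κ + 1) * n))) := by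
        gcongr
        exact (bridgeSum_le_sawCount h e ha n).trans (by gcongr; exact hB n)
      have hlog := Real.log_le_log (mul_pos ha (hpos n)) hle
      have hm : 0 < max a 1 := lt_max_of_lt_left ha
      rw [show a * (max a 1 ^ n * (B * Real.exp ((κ + 1) * n))) =
        a * B * (max a 1 ^ n * Real.exp ((κ + 1) * n)) by ring,
        Real.log_mul (mul_pos ha hB0).ne' (by positivity),
        Real.log_mul (pow_pos hm n).ne' (Real.exp_pos _).ne', Real.log_exp, Real.log_pow] at hlog
      simp only [hu1]
      rw [le_div_iff₀ hn]
      push_cast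
      have h1 := le_abs_self (Real.log (a * B))
      have h2 := le_abs_self (Real.log (max a 1) + (κ + 1))
      have h3 := abs_nonneg (Real.log (a * B))
      have h4 := abs_nonneg (Real.log (max a 1) + (κ + 1))
      have hn0 : (0 : ℝ) ≤ n := n.cast_nonneg
      nlinarith [mul_le_mul_of_nonneg_left h2 hn0, mul_nonneg h3 hn0]
  have hlim := (tendsto_add_atTop_iff_nat 1).2 (hsub.tendsto_lim hbdd)
  have hratio : Tendsto (fun n : ℕ => ((n : ℝ) + 1) / n) atTop (𝓝 1) := by
    have := tendsto_const_nhds (x := (1 : ℝ)).add (tendsto_const_div_atTop_nhds_zero_nat (1 : ℝ))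
    rw [add_zero] at this
    refine this.congr' ?_
    filter_upwards [eventually_gt_atTop 0] with n hn
    have : (n : ℝ) ≠ 0 := by exact_mod_cast hn.ne'
    field_simp
  refine ⟨-hsub.lim * 1 - 0, ((hlim.neg.mul hratio).sub
    (tendsto_const_div_atTop_nhds_zero_nat (Real.log a))).congr' ?_⟩
  filter_upwards [eventually_gt_atTop 0] with n hn
  have : (n : ℝ) ≠ 0 := by exact_mod_cast hn.ne'
  have : (n : ℝ) + 1 ≠ 0 := by positivity
  rw [hu1, Real.log_mul ha.ne' (hpos n).ne']
  push_cast
  field_simp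
  ring

/-- The free energy of positive walks is the larger one of the growth rates of bridges along the
surface and of all self-avoiding walks. -/
theorem tendsto_log_positiveSum {d : ℕ} {h : (Fin d → ℤ) →+ ℤ} {e e' : Fin d}
    (hh : ∀ k, h (Pi.single e k) = 0) (hhe : ∀ x, h x = x e') {a : ℝ} (ha : 0 < a) {κ l : ℝ}
    (hκ : Tendsto (fun n : ℕ => 1 / (n : ℝ) * Real.log (sawCount d n)) atTop (𝓝 κ))
    (hl : Tendsto (fun n : ℕ => 1 / (n : ℝ) * Real.log (bridgeSum h e a n)) atTop (𝓝 l)) :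
    Tendsto (fun n : ℕ => 1 / (n : ℝ) * Real.log (positiveSum h a n)) atTop (𝓝 (max l κ)) := by
  have hZ := bridgeSum_pos hh ha
  have hc : ∀ n, 0 < sawCount d n := fun n => one_pos.trans_le (one_le_sawCount e n)
  have hA : ∀ n, 0 < positiveSum h a n := fun n =>
    (hZ n).trans_le (bridgeSum_le_positiveSum h e ha n)
  have hK : ∀ n, 0 < foldBound n := fun n => one_pos.trans_le (one_le_foldBound n)
  have hlow : Tendsto (fun n : ℕ => 1 / (n : ℝ) *
      (Real.log (sawCount d (n - 1)) - 2 * Real.log (foldBound (n - 1)))) atTop (𝓝 κ) := by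
    rw [← tendsto_add_atTop_iff_nat 1]
    have h1 := (hκ.sub (tendsto_log_foldBound.const_mul 2)).mul
      (tendsto_natCast_div_add_atTop (1 : ℝ))
    rw [mul_zero, sub_zero, mul_one] at h1
    refine h1.congr' ?_
    filter_upwards [eventually_gt_atTop 0] with n hn
    have : (n : ℝ) ≠ 0 := by exact_mod_cast hn.ne'
    rw [Nat.add_sub_cancel]
    push_cast
    field_simp
  refine tendsto_order.2 ⟨fun x hx => ?_, fun x hx => ?_⟩
  · rcases lt_max_iff.1 hx with hx | hx
    · filter_upwards [hl.eventually (lt_mem_nhds hx)] with n hn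
      refine hn.trans_le ?_
      gcongr
      exacts [hZ n, bridgeSum_le_positiveSum h e ha n]
    · filter_upwards [hlow.eventually (lt_mem_nhds hx), eventually_gt_atTop 0] with n hn hn0
      refine hn.trans_le ?_
      gcongr
      obtain ⟨m, rfl⟩ := Nat.exists_eq_add_of_lt hn0
      rw [zero_add, Nat.add_sub_cancel]
      have h1 : sawCount d m ≤ foldBound m ^ 2 * positiveSum h a (m + 1) :=
        (sawCount_le e' m).trans (by gcongr; exact bridgeSum_one_le_positiveSum hhe ha m)
      have h2 := Real.log_le_log (hc m) h1
      rw [Real.log_mul (pow_pos (hK m) 2).ne' (hA _).ne', Real.log_pow] at h2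
      push_cast at h2
      linarith
  · set M := max l κ with hM
    set δ := (x - M) / 2 with hδ
    have hδ0 : 0 < δ := by linarith
    obtain ⟨B, hB0, hB⟩ := exists_le_const_mul_exp hZ hl hδ0
    obtain ⟨B', hB'0, hB'⟩ := exists_le_const_mul_exp hc hκ hδ0
    have hup : ∀ n : ℕ, positiveSum h a n ≤
        ((n : ℝ) + 1) * (foldBound n ^ 2 * (B * B' * Real.exp ((M + δ) * n))) := by
      intro n
      refine (positiveSum_le h ha n).trans ?_
      have hterm : ∀ k ∈ Finset.range (n + 1),
          (∑ w ∈ loops h k, weight h a k w) * sawCount d (n - k) ≤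
            foldBound n ^ 2 * (B * B' * Real.exp ((M + δ) * n)) := by
        intro k hk
        obtain ⟨r, rfl⟩ := Nat.exists_eq_add_of_le (Nat.lt_succ_iff.1 (Finset.mem_range.1 hk))
        rw [Nat.add_sub_cancel_left]
        have hloops : ∑ w ∈ loops h k, weight h a k w ≤ foldBound k ^ 2 * bridgeSum h e a k :=
          sum_loops_le hh ha k
        calc _ ≤ foldBound k ^ 2 * bridgeSum h e a k * sawCount d r :=
              mul_le_mul_of_nonneg_right hloops (hc r).le
          _ ≤ foldBound (k + r) ^ 2 * (B * Real.exp ((l + δ) * k)) *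
              (B' * Real.exp ((κ + δ) * r)) := by
              have := hZ k
              have := hc r
              have := hK k
              gcongr
              exacts [foldBound_mono (by omega), hB k, hB' r]
          _ ≤ foldBound (k + r) ^ 2 * (B * Real.exp ((M + δ) * k)) *
              (B' * Real.exp ((M + δ) * r)) := by
              have := hK (k + r)
              gcongr
              exacts [le_max_left _ _, le_max_right _ _]
          _ = _ := by
              push_cast
              rw [mul_add, Real.exp_add]
              ring
      simpa using Finset.sum_le_card_nsmul _ _ _ hterm
    have hlim : Tendsto (fun n : ℕ => Real.log ((n : ℝ) + 1) / n +
        (2 * (1 / (n : ℝ) * Real.log (foldBound n)) + (Real.log (B * B') / n + (M + δ)))) atTop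
        (𝓝 (0 + (2 * 0 + (0 + (M + δ))))) :=
      tendsto_log_add_one_div.add ((tendsto_log_foldBound.const_mul 2).add
        ((tendsto_const_div_atTop_nhds_zero_nat _).add tendsto_const_nhds))
    filter_upwards [hlim.eventually (gt_mem_nhds (show _ < x by linarith)),
      eventually_gt_atTop 0] with n hn hn0
    refine lt_of_le_of_lt ?_ hn
    have hn' : (0 : ℝ) < n := by exact_mod_cast hn0
    have h1 := Real.log_le_log (hA n) (hup n)
    have := hK n
    rw [Real.log_mul (by positivity) (by positivity), Real.log_mul (by positivity) (by positivity),
      Real.log_mul (by positivity) (by positivity), Real.log_exp, Real.log_pow] at h1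
    rw [one_div, inv_mul_le_iff₀ hn']
    refine h1.trans (le_of_eq ?_)
    push_cast
    field_simp

theorem weight_mono {d : ℕ} (h : (Fin d → ℤ) →+ ℤ) {a b : ℝ} (ha : 0 < a) (hab : a ≤ b) (n : ℕ)
    (w : ℕ → Fin d → ℤ) : weight h a n w ≤ weight h b n w :=
  Finset.prod_le_prod (fun _ _ => by split_ifs <;> positivity) fun _ _ => by
    split_ifs
    exacts [hab, le_rfl]

theorem weight_le_div_pow_mul {d : ℕ} (h : (Fin d → ℤ) →+ ℤ) {a b : ℝ} (ha : 0 < a) (hab : a ≤ b)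
    (n : ℕ) (w : ℕ → Fin d → ℤ) : weight h b n w ≤ (b / a) ^ n * weight h a n w := by
  rw [weight, weight, ← Finset.card_range n, ← Finset.prod_const, Finset.card_range,
    ← Finset.prod_mul_distrib]
  have hb : 0 < b := ha.trans_le hab
  refine Finset.prod_le_prod (fun _ _ => by split_ifs <;> positivity) fun _ _ => ?_
  split_ifs
  · rw [div_mul_cancel₀ _ ha.ne']
  · rw [mul_one, one_le_div ha]
    exact hab

/-! ### Passage to walks indexed by `Fin (n + 1)` -/

theorem image_restrict (d n : ℕ) :
    (fun (w : ℕ → Fin d → ℤ) (i : Fin (n + 1)) => w i) '' {w | IsSAW n w} = walks d n := by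
  ext W
  constructor
  · rintro ⟨w, hw, rfl⟩
    exact IsSAW.restrict_mem_walks hw
  · intro hW
    exact ⟨stopped W, isSAW_stopped hW, funext (stopped_coe W)⟩

theorem walkCount_eq (d n : ℕ) : (walkCount d n : ℝ) = sawCount d n := by
  rw [walkCount, ← image_restrict, (injOn_restrict d n).ncard_image, sawCount, saws,
    Set.ncard_eq_toFinset_card _ (finite_isSAW d n)]

/-- The last coordinate as a homomorphism. -/
def heightHom (d : ℕ) [NeZero d] : (Fin d → ℤ) →+ ℤ where
  toFun := height
  map_zero' := rfl
  map_add' _ _ := rfl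

theorem weight_eq_pow_visits (d n : ℕ) [NeZero d] (a : ℝ) (w : ℕ → Fin d → ℤ) :
    weight (heightHom d) a n w = a ^ visits (fun i : Fin (n + 1) => w i) := by
  classical
  have hv : visits (fun i : Fin (n + 1) => w i) =
      (Finset.univ.filter fun i : Fin n => heightHom d (w (i + 1)) = 0).card := by
    rw [visits, Fin.card_filter_univ_succ]
    simp [heightHom, Fin.succ_ne_zero]
    rfl
  rw [hv, weight, Finset.prod_range, Finset.prod_ite]
  simp

theorem visits_le (d n : ℕ) [NeZero d] (w : Fin (n + 1) → Fin d → ℤ) : visits w ≤ n := by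
  rw [visits, Fin.card_filter_univ_succ]
  simp only [ne_eq, not_true_eq_false, false_and, if_false]
  exact (Finset.card_le_univ _).trans (by simp)

theorem partitionFn_eq (d n : ℕ) [NeZero d] (a : ℝ) :
    partitionFn d n a = positiveSum (heightHom d) a n := by
  classical
  have hcount : ∀ v, positiveCount d n v = ((positiveSaws (heightHom d) n).filter
      fun w => visits (fun i : Fin (n + 1) => w i) = v).card := by
    intro v
    have himage : {W | W ∈ positiveWalks d n ∧ visits W = v} =
        (fun (w : ℕ → Fin d → ℤ) (i : Fin (n + 1)) => w i) ''
          (((positiveSaws (heightHom d) n).filter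
            fun w => visits (fun i : Fin (n + 1) => w i) = v : Finset _) : Set _) := by
      ext W
      simp only [Set.mem_ofPred_eq, Set.mem_image, Finset.coe_filter, mem_positiveSaws]
      constructor
      · rintro ⟨⟨h1, h2⟩, h3⟩
        have h4 : (fun i : Fin (n + 1) => stopped W i) = W := funext (stopped_coe W)
        exact ⟨stopped W, ⟨⟨isSAW_stopped h1, fun i => h2 _⟩, by rw [h4, h3]⟩, h4⟩
      · rintro ⟨w, ⟨⟨h1, h2⟩, h3⟩, rfl⟩
        exact ⟨⟨h1.restrict_mem_walks, fun i => h2 i⟩, h3⟩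
    rw [positiveCount, himage, Set.InjOn.ncard_image, Set.ncard_coe_finset]
    refine (injOn_restrict d n).mono fun w hw => ?_
    exact (mem_positiveSaws.1 (Finset.mem_filter.1 hw).1).1
  rw [positiveSum, partitionFn, ← Finset.sum_fiberwise_of_maps_to
    (t := Finset.range (n + 1)) (g := fun w : ℕ → Fin d → ℤ => visits (fun i : Fin (n + 1) => w i))
    (fun w _ => Finset.mem_range.2 (Nat.lt_succ_of_le (visits_le d n _)))]
  refine Finset.sum_congr rfl fun v _ => ?_
  rw [hcount, Finset.sum_congr rfl fun (w : ℕ → Fin d → ℤ) hw => by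
    rw [weight_eq_pow_visits, (Finset.mem_filter.1 hw).2]]
  rw [Finset.sum_const, nsmul_eq_mul]

/-! ### The free energy and the critical point -/

theorem height_single {d : ℕ} [NeZero d] (hd : 2 ≤ d) (k : ℤ) :
    heightHom d (Pi.single (⟨0, NeZero.pos d⟩ : Fin d) k) = 0 := by
  change (Pi.single (⟨0, NeZero.pos d⟩ : Fin d) k : Fin d → ℤ) _ = 0
  refine Pi.single_eq_of_ne ?_ _
  rw [Ne, Fin.mk.injEq]
  omega

theorem pow_le_partitionFn {d : ℕ} [NeZero d] (hd : 2 ≤ d) {a : ℝ} (ha : 0 < a) (n : ℕ) :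
    a ^ n ≤ partitionFn d n a := by
  rw [partitionFn_eq]
  exact (pow_le_bridgeSum (height_single hd) ha n).trans (bridgeSum_le_positiveSum _ _ ha n)

theorem partitionFn_pos {d : ℕ} [NeZero d] (hd : 2 ≤ d) {a : ℝ} (ha : 0 < a) (n : ℕ) :
    0 < partitionFn d n a :=
  (pow_pos ha n).trans_le (pow_le_partitionFn hd ha n)

theorem partitionFn_mono {d : ℕ} [NeZero d] {a b : ℝ} (ha : 0 < a) (hab : a ≤ b) (n : ℕ) :
    partitionFn d n a ≤ partitionFn d n b := by
  rw [partitionFn_eq, partitionFn_eq]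
  exact Finset.sum_le_sum fun w _ => weight_mono _ ha hab n w

theorem partitionFn_le_div_pow_mul {d : ℕ} [NeZero d] {a b : ℝ} (ha : 0 < a) (hab : a ≤ b)
    (n : ℕ) : partitionFn d n b ≤ (b / a) ^ n * partitionFn d n a := by
  rw [partitionFn_eq, partitionFn_eq, positiveSum, positiveSum, Finset.mul_sum]
  exact Finset.sum_le_sum fun w _ => weight_le_div_pow_mul _ ha hab n w

theorem partitionFn_le_walkCount {d : ℕ} [NeZero d] {a : ℝ} (ha : 0 < a) (ha1 : a ≤ 1) (n : ℕ) :
    partitionFn d n a ≤ walkCount d n := by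
  have := positiveSum_le_sawCount (heightHom d) ha n
  rwa [max_eq_right ha1, one_pow, one_mul, ← walkCount_eq, ← partitionFn_eq] at this

theorem one_le_walkCount (d : ℕ) [NeZero d] (n : ℕ) : (1 : ℝ) ≤ walkCount d n := by
  rw [walkCount_eq]
  exact one_le_sawCount ⟨0, NeZero.pos d⟩ n

theorem tendsto_walkCount_rpow {d : ℕ} [NeZero d] {κ : ℝ}
    (hκ : Tendsto (fun n : ℕ => 1 / (n : ℝ) * Real.log (walkCount d n)) atTop (𝓝 κ)) :
    Tendsto (fun n : ℕ => (walkCount d n : ℝ) ^ (1 / (n : ℝ))) atTop (𝓝 (Real.exp κ)) := by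
  refine ((Real.continuous_exp.tendsto κ).comp hκ).congr fun n => ?_
  rw [Real.rpow_def_of_pos (one_pos.trans_le (one_le_walkCount d n)), mul_comm]
  rfl

theorem exists_freeEnergy {d : ℕ} [NeZero d] (hd : 2 ≤ d) :
    ∃ κ, Tendsto (fun n : ℕ => 1 / (n : ℝ) * Real.log (walkCount d n)) atTop (𝓝 κ) ∧
      ∀ a, 0 < a → ∃ Λ, κ ≤ Λ ∧
        Tendsto (fun n : ℕ => 1 / (n : ℝ) * Real.log (partitionFn d n a)) atTop (𝓝 Λ) := by
  obtain ⟨κ, hκ⟩ := exists_tendsto_log_sawCount (⟨0, NeZero.pos d⟩ : Fin d)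
  refine ⟨κ, by simpa only [walkCount_eq] using hκ, fun a ha => ?_⟩
  obtain ⟨l, hl⟩ := exists_tendsto_log_bridgeSum (height_single hd) ha
  refine ⟨max l κ, le_max_right _ _, ?_⟩
  simp only [partitionFn_eq]
  exact tendsto_log_positiveSum (height_single hd) (fun _ => rfl) ha hκ hl

/-- The part of the phase diagram that follows from continuity and monotonicity of a free energy
`Λ` alone. -/
theorem phase_separation {Λ : ℝ → ℝ} {κ : ℝ} (hκ : ∀ a, 0 < a → κ ≤ Λ a) (h1 : Λ 1 = κ)
    (hmono : ∀ a b, 0 < a → a ≤ b → Λ a ≤ Λ b)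
    (hlip : ∀ a b, 0 < a → a ≤ b → Λ b ≤ Real.log (b / a) + Λ a)
    (hlog : ∀ a, 0 < a → Real.log a ≤ Λ a) :
    0 < sSup {a : ℝ | 0 < a ∧ Λ a = κ} ∧ ∀ a, 0 < a →
      (a ≤ sSup {a : ℝ | 0 < a ∧ Λ a = κ} → Λ a = κ) ∧
      (sSup {a : ℝ | 0 < a ∧ Λ a = κ} < a → κ < Λ a) := by
  set S := {a : ℝ | 0 < a ∧ Λ a = κ} with hS
  have hmem : (1 : ℝ) ∈ S := ⟨one_pos, h1⟩
  have hbdd : BddAbove S := by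
    refine ⟨Real.exp κ, fun a ha => ?_⟩
    rw [← Real.log_le_iff_le_exp ha.1, ← ha.2]
    exact hlog a ha.1
  have hpos : 0 < sSup S := one_pos.trans_le (le_csSup hbdd hmem)
  refine ⟨hpos, fun a ha => ⟨fun hle => ?_, fun hlt => ?_⟩⟩
  · refine le_antisymm ((hmono a _ ha hle).trans ?_) (hκ a ha)
    by_contra hcon
    push Not at hcon
    -- an activity in `S` so close to the supremum that the Lipschitz bound is violated
    obtain ⟨b, hb, hlt⟩ := exists_lt_of_lt_csSup ⟨1, hmem⟩
      (show sSup S * Real.exp (-(Λ (sSup S) - κ)) < sSup S from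
        mul_lt_of_lt_one_right hpos (Real.exp_lt_one_iff.2 (by linarith)))
    have h2 := hlip b (sSup S) hb.1 (le_csSup hbdd hb)
    have h3 : Real.log (sSup S / b) < Λ (sSup S) - κ := by
      rw [Real.log_lt_iff_lt_exp (div_pos hpos hb.1), div_lt_iff₀ hb.1]
      rw [Real.exp_neg, ← div_eq_mul_inv, div_lt_iff₀ (Real.exp_pos _)] at hlt
      linarith
    rw [hb.2] at h2
    linarith
  · refine lt_of_le_of_ne (hκ a ha) fun heq => ?_
    exact absurd (le_csSup hbdd (show a ∈ S from ⟨ha, heq.symm⟩)) (not_le.2 hlt)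

end AdsorbingWalk

theorem theorem3p4 (d : ℕ) [NeZero d] (hd : 2 ≤ d) :
    -- the growth constant and the free energy are genuine limits
    Tendsto (fun n : ℕ => (AdsorbingWalk.walkCount d n : ℝ) ^ (1 / (n : ℝ))) atTop
      (𝓝 (AdsorbingWalk.growthConstant d)) ∧
    (∀ a : ℝ, 0 < a →
      Tendsto (fun n : ℕ => 1 / (n : ℝ) * Real.log (AdsorbingWalk.partitionFn d n a)) atTop
        (𝓝 (AdsorbingWalk.freeEnergy d a))) ∧
    -- the critical point separates the two phases
    0 < AdsorbingWalk.criticalPoint d ∧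
    (∀ a : ℝ, 0 < a →
      (a ≤ AdsorbingWalk.criticalPoint d →
        AdsorbingWalk.freeEnergy d a = Real.log (AdsorbingWalk.growthConstant d)) ∧
      (AdsorbingWalk.criticalPoint d < a →
        Real.log (AdsorbingWalk.growthConstant d) < AdsorbingWalk.freeEnergy d a)) ∧
    -- the zeros accumulate on the unit circle
    ∀ a : ℝ, 0 < a → ∀ ρ : ℝ, 0 < ρ → ρ < 1 → ∀ ε : ℝ, 0 < ε →
      ∃ N₀ : ℕ, ∀ N : ℕ, N₀ ≤ N →
        |1 - 1 / (N : ℝ) *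
          (AdsorbingWalk.annulusZeros (AdsorbingWalk.rescaledGF d N a) ρ : ℝ)| < ε := by
  open AdsorbingWalk in
  obtain ⟨κ, hκ, hΛ⟩ := exists_freeEnergy hd
  have hμ := tendsto_walkCount_rpow hκ
  have hgrowth : growthConstant d = Real.exp κ := hμ.limUnder_eq
  have hlim : ∀ a : ℝ, 0 < a →
      Tendsto (fun n : ℕ => 1 / (n : ℝ) * Real.log (partitionFn d n a)) atTop
        (𝓝 (freeEnergy d a)) := fun a ha => by
    obtain ⟨L, -, hL⟩ := hΛ a ha
    rwa [freeEnergy, hL.limUnder_eq]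
  have hκle : ∀ a, 0 < a → κ ≤ freeEnergy d a := fun a ha => by
    obtain ⟨L, hκL, hL⟩ := hΛ a ha
    rwa [tendsto_nhds_unique (hlim a ha) hL]
  have hone : freeEnergy d 1 = κ := by
    refine le_antisymm (le_of_tendsto_of_tendsto' (hlim 1 one_pos) hκ fun n => ?_)
      (hκle 1 one_pos)
    gcongr
    exacts [partitionFn_pos hd one_pos n, partitionFn_le_walkCount one_pos le_rfl n]
  obtain ⟨hc0, hc⟩ := phase_separation (Λ := freeEnergy d) hκle hone
    (fun a b ha hab => le_of_tendsto_of_tendsto' (hlim a ha) (hlim b (ha.trans_le hab))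
      fun n => by
        gcongr
        exacts [partitionFn_pos hd ha n, partitionFn_mono ha hab n])
    (fun a b ha hab => by
      have hb := ha.trans_le hab
      refine le_of_tendsto_of_tendsto (hlim b hb)
        ((tendsto_const_nhds (x := Real.log (b / a))).add (hlim a ha)) ?_
      filter_upwards [eventually_gt_atTop 0] with n hn
      have hn' : (n : ℝ) ≠ 0 := by exact_mod_cast hn.ne'
      have h1 := Real.log_le_log (partitionFn_pos hd hb n) (partitionFn_le_div_pow_mul ha hab n)
      rw [Real.log_mul (pow_pos (div_pos hb ha) n).ne' (partitionFn_pos hd ha n).ne',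
        Real.log_pow] at h1
      calc 1 / (n : ℝ) * Real.log (partitionFn d n b)
          ≤ 1 / (n : ℝ) * (n * Real.log (b / a) + Real.log (partitionFn d n a)) := by gcongr
        _ = _ := by field_simp)
    (fun a ha => by
      refine ge_of_tendsto (hlim a ha) ?_
      filter_upwards [eventually_gt_atTop 0] with n hn
      have hn' : (0 : ℝ) < n := by exact_mod_cast hn
      have h1 := Real.log_le_log (pow_pos ha n) (pow_le_partitionFn hd ha n)
      rw [Real.log_pow] at h1
      rw [one_div, le_inv_mul_iff₀ hn']
      exact h1)
  have hlogμ : Real.log (growthConstant d) = κ := by rw [hgrowth, Real.log_exp]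
  refine ⟨by rwa [hgrowth], hlim, ?_, ?_, ?_⟩
  · rw [criticalPoint, hlogμ]
    exact hc0
  · rw [criticalPoint, hlogμ]
    exact hc
  · intro a ha ρ hρ hρ1 ε hε
    have hrate : growthRate d a = Real.exp (freeEnergy d a) := by
      unfold growthRate
      split_ifs with hac
      · rw [criticalPoint, hlogμ] at hac
        rw [hgrowth, (hc a ha).1 hac]
      · rfl
    have hpos := partitionFn_pos hd ha
    refine tendsto_annulusZeros (p := fun n => partitionFn d n a / growthRate d a ^ n)
      (fun n => ?_) ?_ hρ hρ1 hε
    · rw [hrate]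
      exact div_pos (hpos n) (by positivity)
    · have h0 := (hlim a ha).sub_const (freeEnergy d a)
      rw [sub_self] at h0
      refine h0.congr' ?_
      filter_upwards [eventually_gt_atTop 0] with n hn
      have hn' : (n : ℝ) ≠ 0 := by exact_mod_cast hn.ne'
      rw [hrate, Real.log_div (hpos n).ne' (by positivity), Real.log_pow, Real.log_exp]
      field_simp
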